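/- **Setting.** Let $qVar$ be a countably infinite set of quantum variables (qubits), each $q$ with a state space $\mathcal H_q\cong\mathbb C^2$. For $V\subseteq qVar$ let $\mathcal H_V=\bigotimes_{q\in V}\mathcal H_q$, the separable tensor product along the reference state $|00\ldots\rangle$ (its orthonormal basis consists of the bit assignments on $V$ with finitely many ones), let $\mathcal H=\mathcal H_{qVar}$, and let $\mathcal D(\mathcal H)$ be the set of density operators on $\mathcal H$ (positive, trace $1$). $\mathcal{SO}(\mathcal H_V)$ is the set of completely positive trace-preserving maps on (trace-class) operators on $\mathcal H_V$; they act on $\mathcal D(\mathcal H)$ by tensoring with the identity on the qubits outside $V$. Write $\overline V=qVar\setminus V$. **Processes.** Given sets of classical and of quantum channels, real-valued classical expressions $e$ (built from variables, real constants and function symbols), boolean expressions $b$ (built from comparisons of expressions and propositional connectives) and process constants $A$, the terms of qCCS are $$P::=\mathbf{nil}\mid\tau.P\mid c?x.P\mid c!e.P\mid \mathtt c?q.P\mid\mathtt c!q.P\mid\mathcal E[\tilde q].P\mid M[\tilde q;x].P\mid P+P\mid P\,\|\,P\mid P[f]\mid P\backslash L\mid\mathbf{if}\ b\ \mathbf{then}\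 P\mid A(\tilde q;\tilde x),$$ up to renaming of bound variables, where $\tilde q$ is a finite list of distinct quantum variables, $\mathcal E$ a trace-preserving super-operator and $M$ a non-degenerate projective measurement on the qubits $\tilde q$, $f$ a relabelling of channels that respects their two kinds, and $L$ a set of channels; $c?x$ and $M[\tilde q;x]$ bind $x$, and $\mathtt c?q$ binds $q$. The set of free quantum variables is $qv(P)$, with $qv(A(\tilde q;\tilde x))=\tilde q$. Terms are legal: $q\notin qv(P)$ in $\mathtt c!q.P$, $qv(P)\cap qv(Q)=\emptyset$ in $P\|Q$, and each constant has a defining equation $A(\tilde q;\tilde x):=P$ with free variables of $P$ among $\tilde q,\tilde x$. A *configuration* is a pair $\langle P,\rho\rangle$ of a process $P$ without free classical variables and $\rho\in\mathcal D(\mathcal H)$. For $\mathcal C=\langle P,\rho\rangle$ put $qv(\mathcal C)=qv(P)$, $\mathrm{ptr}(\mathcal C)=\mathrm{tr}_{qv(P)}(\rho)$ and $\mathcal E(\mathcal C)=\langle P,\mathcal E(\rho)\rangle$. **Transitions.** Actions $\alpha$ are $\tau$, $c?v$, $c!v$ ($v\in\mathbb R$), $\mathtt c?r$ and $\mathtt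 c!r$ ($r\in qVar$). Transitions $\mathcal C\xrightarrow{\alpha}\Delta$ from configurations to probability distributions on configurations are generated by the following rules (a configuration on the right stands for its point distribution): - $\langle\tau.P,\rho\rangle\xrightarrow{\tau}\langle P,\rho\rangle$; $\langle c?x.P,\rho\rangle\xrightarrow{c?v}\langle P[v/x],\rho\rangle$ for all $v\in\mathbb R$; $\langle c!e.P,\rho\rangle\xrightarrow{c!v}\langle P,\rho\rangle$ for $v$ the value of $e$; $\langle\mathtt c?q.P,\rho\rangle\xrightarrow{\mathtt c?r}\langle P[r/q],\rho\rangle$ if $r\notin qv(\mathtt c?q.P)$; $\langle\mathtt c!q.P,\rho\rangle\xrightarrow{\mathtt c!q}\langle P,\rho\rangle$; - $\langle\mathcal E[\tilde q].P,\rho\rangle\xrightarrow{\tau}\langle P,\mathcal E_{\tilde q}(\rho)\rangle$; if $M=\sum_i\lambda_iE^i$ is the spectral decomposition and $p_i=\mathrm{tr}(E^i_{\tilde q}\rho)$, then $\langle M[\tilde q;x].P,\rho\rangle\xrightarrow{\tau}\sum_ip_i\,\langle P[\lambda_i/x],E^i_{\tilde q}\rho E^i_{\tilde q}/p_i\rangle$;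 - if $\langle P_1,\rho\rangle$ and $\langle P_2,\rho\rangle$ can perform a complementary input and output of the same datum on the same channel, to $\langle P_1',\rho\rangle$ and $\langle P_2',\rho\rangle$, then $\langle P_1\|P_2,\rho\rangle\xrightarrow{\tau}\langle P_1'\|P_2',\rho\rangle$; if $\langle P_1,\rho\rangle\xrightarrow{\alpha}\Delta$, and $r\notin qv(P_2)$ in case $\alpha=\mathtt c?r$, then $\langle P_1\|P_2,\rho\rangle\xrightarrow{\alpha}\Delta\|P_2$; and symmetrically; - if $\langle P,\rho\rangle\xrightarrow{\alpha}\Delta$, then $\langle P+Q,\rho\rangle\xrightarrow{\alpha}\Delta$ and $\langle Q+P,\rho\rangle\xrightarrow{\alpha}\Delta$; $\langle P[f],\rho\rangle\xrightarrow{f(\alpha)}\Delta[f]$; $\langle P\backslash L,\rho\rangle\xrightarrow{\alpha}\Delta\backslash L$ if the channel of $\alpha$ is not in $L$; $\langle\mathbf{if}\ b\ \mathbf{then}\ P,\rho\rangle\xrightarrow{\alpha}\Delta$ if $b$ is true; - $\langle A(\tilde r;\tilde v),\rho\rangle\xrightarrow{\alpha}\Delta$ if $A(\tilde q;\tilde x):=P$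 and $\langle P[\tilde v/\tilde x,\tilde r/\tilde q],\rho\rangle\xrightarrow{\alpha}\Delta$. **Lifting and weak transitions.** A relation $R$ between states and distributions is lifted to distributions: $\Delta\,R^\dagger\,\Theta$ iff, for some finite $I$ and $p_i\ge0$ with $\sum_{i\in I}p_i=1$, $\Delta=\sum_ip_i\overline{s_i}$ and $\Theta=\sum_ip_i\Theta_i$ with $s_i\,R\,\Theta_i$ for all $i\in I$ (where $\overline s$ is the point distribution). A relation $R$ between states is lifted through $\{(s,\overline t): s\,R\,t\}$. Let $\xrightarrow{\hat\tau}$ be $\xrightarrow{\tau}$ together with all $(\mathcal C,\overline{\mathcal C})$, and $\xrightarrow{\hat\alpha}$ be $\xrightarrow{\alpha}$ for $\alpha\ne\tau$. On distributions, $\stackrel{\hat\tau}{\Rightarrow}$ is the reflexive transitive closure of the lifted $\xrightarrow{\hat\tau}$, and $\stackrel{\hat\alpha}{\Rightarrow}$ is $\stackrel{\hat\tau}{\Rightarrow}$, then the lifted $\xrightarrow{\hat\alpha}$, then $\stackrel{\hat\tau}{\Rightarrow}$, for $\alpha\neq\tau$. From a configuration it means from its point distribution. **Open bisimilarity.** A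 relation $R$ on configurations is an open simulation if $\mathcal C\,R\,\mathcal D$ implies $qv(\mathcal C)=qv(\mathcal D)$, $\mathrm{ptr}(\mathcal C)=\mathrm{ptr}(\mathcal D)$ and, for every $\mathcal E\in\mathcal{SO}(\mathcal H_{\overline{qv(\mathcal C)}})$: whenever $\mathcal E(\mathcal C)\xrightarrow{\alpha}\Delta$ there is $\Theta$ with $\mathcal E(\mathcal D)\stackrel{\hat\alpha}{\Rightarrow}\Theta$ and $\Delta\,R^\dagger\,\Theta$. It is an open bisimulation if $R$ and $R^{-1}$ are open simulations. $\approx_o$ is the union of all open bisimulations. **Logic.** Formulae are given by $$\phi::=E_{\tilde q}^{\ge p}\mid\bigwedge_{i\in I}\phi_i\mid\langle\alpha\rangle\psi\mid\neg\phi\mid\mathcal E.\phi,\qquad\psi::=\bigoplus_{i\in I}p_i\cdot\phi_i,$$ with $E$ an orthogonal projector on the qubits of a finite list $\tilde q$ of distinct quantum variables, $p$ real, arbitrary index sets in conjunctions, finite index sets and $p_i\ge0$, $\sum_ip_i=1$ in $\bigoplus$, and $\mathcal E$ a trace-preserving super-operator on some $\mathcal H_V$. Satisfaction, for $\mathcal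 C=\langle P,\rho\rangle$: - $\mathcal C\models E_{\tilde q}^{\ge p}$ iff $qv(\mathcal C)\cap\tilde q=\emptyset$ and $\mathrm{tr}(E_{\tilde q}\rho)\ge p$; - $\mathcal C\models\bigwedge_{i\in I}\phi_i$ iff $\mathcal C\models\phi_i$ for all $i\in I$; $\mathcal C\models\neg\phi$ iff not $\mathcal C\models\phi$; - $\mathcal C\models\langle\alpha\rangle\psi$ iff $\mathcal C\stackrel{\hat\alpha}{\Rightarrow}\Delta$ and $\Delta\models\psi$ for some distribution $\Delta$; - $\mathcal C\models\mathcal E.\phi$ iff $\mathcal E\in\mathcal{SO}(\mathcal H_{\overline{qv(\mathcal C)}})$ and $\mathcal E(\mathcal C)\models\phi$; - $\Delta\models\bigoplus_{i\in I}p_i\cdot\phi_i$ iff there are distributions $\Delta_i$ $(i\in I)$ with $\Delta=\sum_ip_i\Delta_i$ and $\mathcal D\models\phi_i$ for all $i\in I$ and all $\mathcal D$ in the support of $\Delta_i$. **Theorem.** For any two configurations $\mathcal C$ and $\mathcal D$: $\mathcal C\approx_o\mathcal D$ if and only if, for every formula $\phi$, $\mathcal C\models\phi\Leftrightarrow\mathcal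 D\models\phi$. -/

import Mathlib

open scoped ComplexOrder InnerProductSpace Matrix

noncomputable section

namespace QCCS

/-! ### The state space of the quantum environment -/

/-- Quantum variables: a countably infinite set of names of qubits. -/
abbrev QVar : Type := ℕ

/-- The complex Hilbert space with orthonormal basis indexed by `ι`. -/
abbrev Hilb (ι : Type) : Type := lp (fun _ : ι => ℂ) 2

/-- Bounded linear operators on the Hilbert space with basis `ι`. -/
abbrev Op (ι : Type) : Type := Hilb ι →L[ℂ] Hilb ι

/-- Computational basis states of all the qubits. Only finitely many qubits are in state `1`, so
that `Hilb EnvIdx` is the separable tensor product of countably many qubits along the reference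
state `|000...⟩`. -/
abbrev EnvIdx : Type := QVar →₀ Fin 2

/-- Computational basis states of the qubits in `V`; the space `H_V` is `Hilb (SubIdx V)`. -/
abbrev SubIdx (V : Set QVar) : Type := V →₀ Fin 2

open Classical in
/-- The basis vector `|i⟩`. -/
def ket {ι : Type} (i : ι) : Hilb ι := lp.single 2 i (1 : ℂ)

theorem orthonormal_ket {ι : Type} : Orthonormal ℂ (ket : ι → Hilb ι) := by
  classical
  have h := (default : HilbertBasis ι ℂ (Hilb ι)).orthonormal
  have e : ((default : HilbertBasis ι ℂ (Hilb ι)) : ι → Hilb ι) = ket := by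
    funext i
    exact ((default : HilbertBasis ι ℂ (Hilb ι)).repr_symm_single i).symm
  rwa [e] at h

/-- The isometry `Hilb κ → Hilb ι` that sends `|a⟩` to `|v a⟩`, for an injection `v`. -/
def basisIsometry {κ ι : Type} (v : κ → ι) (hv : Function.Injective v) : Hilb κ →L[ℂ] Hilb ι :=
  (OrthogonalFamily.linearIsometry
    (orthonormal_ket.comp v hv).orthogonalFamily).toContinuousLinearMap

open Classical in
/-- The basis state of the environment that is `a` on `V` and `k` off `V`. -/
def joinIdx (V : Set QVar) (a : SubIdx V) (k : SubIdx Vᶜ) : EnvIdx :=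
  Finsupp.piecewise (P := fun x => x ∈ V) a k

theorem joinIdx_of_mem {V : Set QVar} (a : SubIdx V) (k : SubIdx Vᶜ) (x : V) :
    joinIdx V a k x = a x := by
  simp [joinIdx, Finsupp.piecewise]

theorem joinIdx_of_notMem {V : Set QVar} (a : SubIdx V) (k : SubIdx Vᶜ) (x : (Vᶜ : Set QVar)) :
    joinIdx V a k x = k x := by
  have hx : ¬ (x : QVar) ∈ V := x.2
  simp [joinIdx, Finsupp.piecewise, hx]

theorem joinIdx_left_injective (V : Set QVar) (k : SubIdx Vᶜ) :
    Function.Injective fun a => joinIdx V a k := by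
  intro a a' h
  ext x
  have h' : joinIdx V a k = joinIdx V a' k := h
  rw [← joinIdx_of_mem a k, h', joinIdx_of_mem]

theorem joinIdx_right_injective (V : Set QVar) (a : SubIdx V) :
    Function.Injective fun k => joinIdx V a k := by
  intro k k' h
  ext x
  have h' : joinIdx V a k = joinIdx V a k' := h
  rw [← joinIdx_of_notMem a k, h', joinIdx_of_notMem]

/-- The isometry `ψ ↦ ψ ⊗ |k⟩` from `H_V` to the environment, for `|k⟩` a basis state off `V`. -/
def attach (V : Set QVar) (k : SubIdx Vᶜ) : Hilb (SubIdx V) →L[ℂ] Hilb EnvIdx :=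
  basisIsometry (fun a => joinIdx V a k) (joinIdx_left_injective V k)

/-- The operator `⟨k|T|l⟩` on `H_V`. -/
def block (V : Set QVar) (T : Op EnvIdx) (k l : SubIdx Vᶜ) : Op (SubIdx V) :=
  (attach V k).adjoint ∘L T ∘L attach V l

/-- The matrix entry `⟨i|T|i⟩`. -/
def diagEntry {ι : Type} (T : Op ι) (i : ι) : ℂ := ⟪ket i, T (ket i)⟫_ℂ

/-- The trace in the computational basis. It is only applied to operators of trace class. -/
def tr {ι : Type} (T : Op ι) : ℂ := ∑' i, diagEntry T i

/-- Density operators of the environment: positive operators of trace one. -/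
structure Density : Type where
  op : Op EnvIdx
  positive : op.IsPositive
  trace_one : HasSum (diagEntry op) 1

/-- The partial trace of `T` over all qubits outside `V`, an operator on `H_V`. -/
def reduced (V : Set QVar) (T : Op EnvIdx) : Op (SubIdx V) :=
  ∑' k : SubIdx Vᶜ, block V T k k

/-! ### Trace-preserving super-operators on `H_V` -/

/-- Positivity of an operator on `ℂ^r ⊗ Hilb ι`, given as an `r × r` array of operators. -/
def IsPosArray {ι : Type} {r : ℕ} (A : Fin r → Fin r → Op ι) : Prop :=
  ∀ x : Fin r → Hilb ι, 0 ≤ ∑ i, ∑ j, ⟪x i, A i j (x j)⟫_ℂ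

/-- `F` is completely positive and trace-preserving on the trace-class operators on `Hilb ι`
(its values on other operators are irrelevant). -/
structure IsTracePreservingCP {ι : Type} (F : Op ι →ₗ[ℂ] Op ι) : Prop where
  cp : ∀ (r : ℕ) (A : Fin r → Fin r → Op ι), IsPosArray A →
    (∀ i, Summable (diagEntry (A i i))) → IsPosArray fun i j => F (A i j)
  tp : ∀ A : Op ι, A.IsPositive → Summable (diagEntry A) → HasSum (diagEntry (F A)) (tr A)

/-- `E` is the action on density operators of `F ⊗ id` for some `F` in `SO(H_V)`, the identity
acting on the qubits outside `V`. -/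
def IsSuperOpOn (V : Set QVar) (E : Density → Density) : Prop :=
  ∃ F : Op (SubIdx V) →ₗ[ℂ] Op (SubIdx V), IsTracePreservingCP F ∧
    ∀ (ρ : Density) (k l : SubIdx Vᶜ), block V (E ρ).op k l = F (block V ρ.op k l)

/-- Trace-preserving super-operators on subsystems of the environment. -/
def EnvSuperOp : Type := {E : Density → Density // ∃ V, IsSuperOpOn V E}

/-! ### Operators on finite lists of qubits -/

/-- Computational basis states of `n` qubits. -/
abbrev Bits (n : ℕ) : Type := Fin n → Fin 2

/-- The basis state `a` of the qubits `q 0, …, q (n-1)`. -/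
def bitsIdx {n : ℕ} (q : Fin n ↪ QVar) (a : Bits n) : SubIdx (Set.range q) :=
  Finsupp.equivFunOnFinite.symm (a ∘ (Equiv.ofInjective q q.injective).symm)

/-- The isometry `ψ ↦ |a⟩ ⊗ ψ`, where `|a⟩` is the state of the qubits `q`. -/
def ketAt {n : ℕ} (q : Fin n ↪ QVar) (a : Bits n) :
    Hilb (SubIdx (Set.range q)ᶜ) →L[ℂ] Hilb EnvIdx :=
  basisIsometry (fun k => joinIdx (Set.range q) (bitsIdx q a) k)
    (joinIdx_right_injective (Set.range q) (bitsIdx q a))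

/-- The operator `|a⟩⟨b| ⊗ I` with `|a⟩⟨b|` acting on the qubits `q`. -/
def unitAt {n : ℕ} (q : Fin n ↪ QVar) (a b : Bits n) : Op EnvIdx :=
  ketAt q a ∘L (ketAt q b).adjoint

/-- The operator `A ⊗ I` with `A` acting on the qubits `q`. -/
def opAt {n : ℕ} (q : Fin n ↪ QVar) (A : Matrix (Bits n) (Bits n) ℂ) : Op EnvIdx :=
  ∑ a, ∑ b, A a b • unitAt q a b

/-- Trace-preserving super-operators on `n` qubits. -/
structure SuperOp (n : ℕ) : Type where
  map : Matrix (Bits n) (Bits n) ℂ →ₗ[ℂ] Matrix (Bits n) (Bits n) ℂ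
  cp : ∀ (r : ℕ) (A : Matrix (Fin r × Bits n) (Fin r × Bits n) ℂ), A.PosSemidef →
    (Matrix.of fun x y : Fin r × Bits n =>
      map (Matrix.of fun a b => A (x.1, a) (y.1, b)) x.2 y.2).PosSemidef
  tp : ∀ A : Matrix (Bits n) (Bits n) ℂ, A.PosSemidef → (map A).trace = A.trace

/-- `(E ⊗ id)(T)` with `E` acting on the qubits `q`: the linear extension of
`(|b⟩⟨c| ⊗ S) ↦ E(|b⟩⟨c|) ⊗ S`. -/
def SuperOp.applyAt {n : ℕ} (E : SuperOp n) (q : Fin n ↪ QVar) (T : Op EnvIdx) : Op EnvIdx :=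
  ∑ b, ∑ c, ∑ a, ∑ d,
    (E.map (Matrix.single b c 1)) a d • (unitAt q a b ∘L T ∘L unitAt q c d)

/-- Non-degenerate projective measurements on `n` qubits: Hermitian matrices without repeated
eigenvalues. -/
structure Measurement (n : ℕ) : Type where
  mat : Matrix (Bits n) (Bits n) ℂ
  herm : mat.IsHermitian
  nondeg : Function.Injective herm.eigenvalues

/-- The projector onto the eigenspace of the `i`-th eigenvalue. -/
def Measurement.proj {n : ℕ} (M : Measurement n) (i : Bits n) : Matrix (Bits n) (Bits n) ℂ :=
  Matrix.vecMulVec (M.herm.eigenvectorBasis i).ofLp (star (M.herm.eigenvectorBasis i).ofLp)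

/-- Orthogonal projectors on `n` qubits. -/
def Projector (n : ℕ) : Type := {E : Matrix (Bits n) (Bits n) ℂ // IsStarProjection E}

/-! ### Terms

Terms are taken up to renaming of bound variables, by de Bruijn indices. In `Proc L m k` there are
`m` bound classical variables and `k` bound quantum variables in scope, the most recently bound one
having index `0`. Free quantum variables are names in `QVar`. -/

/-- The parameters of the language: classical and quantum channels, the function symbols of
classical expressions with their meaning, and the constants with the lengths of their lists of
quantum and of classical parameters. -/
structure Signature : Type 1 where
  CChan : Type
  QChan : Type
  Fn : Type
  arity : Fn → ℕ
  interp : (f : Fn) → (Fin (arity f) → ℝ) → ℝ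
  Const : Type
  nq : Const → ℕ
  nc : Const → ℕ

/-- Real-valued classical expressions with `m` variables. -/
inductive Exp (L : Signature) (m : ℕ) : Type
  | var (i : Fin m)
  | val (v : ℝ)
  | app (f : L.Fn) (args : Fin (L.arity f) → Exp L m)

/-- A classical variable or a value. -/
abbrev CArg (m : ℕ) : Type := Fin m ⊕ ℝ

def Exp.subst {L : Signature} {m m' : ℕ} (s : Fin m → CArg m') : Exp L m → Exp L m'
  | .var i => Sum.elim .var .val (s i)
  | .val v => .val v
  | .app f args => .app f fun j => (args j).subst s

/-- The value of a closed expression. -/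
def Exp.eval {L : Signature} : Exp L 0 → ℝ
  | .var i => i.elim0
  | .val v => v
  | .app f args => L.interp f fun j => (args j).eval

inductive Cmp : Type
  | gt | lt | ge | le | eq

def Cmp.holds : Cmp → ℝ → ℝ → Prop
  | .gt, x, y => x > y
  | .lt, x, y => x < y
  | .ge, x, y => x ≥ y
  | .le, x, y => x ≤ y
  | .eq, x, y => x = y

/-- Boolean-valued expressions. -/
inductive BExp (L : Signature) (m : ℕ) : Type
  | tt
  | ff
  | neg (b : BExp L m)
  | conj (b b' : BExp L m)
  | disj (b b' : BExp L m)
  | imp (b b' : BExp L m)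
  | cmp (o : Cmp) (e e' : Exp L m)

def BExp.subst {L : Signature} {m m' : ℕ} (s : Fin m → CArg m') : BExp L m → BExp L m'
  | .tt => .tt
  | .ff => .ff
  | .neg b => .neg (b.subst s)
  | .conj b b' => .conj (b.subst s) (b'.subst s)
  | .disj b b' => .disj (b.subst s) (b'.subst s)
  | .imp b b' => .imp (b.subst s) (b'.subst s)
  | .cmp o e e' => .cmp o (e.subst s) (e'.subst s)

/-- The truth of a closed boolean expression. -/
def BExp.holds {L : Signature} : BExp L 0 → Prop
  | .tt => True
  | .ff => False
  | .neg b => ¬ b.holds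
  | .conj b b' => b.holds ∧ b'.holds
  | .disj b b' => b.holds ∨ b'.holds
  | .imp b b' => b.holds → b'.holds
  | .cmp o e e' => o.holds e.eval e'.eval

/-- An occurrence of a quantum variable: free, or bound. -/
abbrev QRef (k : ℕ) : Type := QVar ⊕ Fin k

/-- A relabelling function maps classical channels to classical ones and quantum channels to
quantum ones. -/
structure Relabelling (L : Signature) : Type where
  onC : L.CChan → L.CChan
  onQ : L.QChan → L.QChan

inductive Proc (L : Signature) : ℕ → ℕ → Type
  | nil {m k : ℕ} : Proc L m k
  | tau {m k : ℕ} (P : Proc L m k) : Proc L m k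
  | cin {m k : ℕ} (c : L.CChan) (P : Proc L (m + 1) k) : Proc L m k
  | cout {m k : ℕ} (c : L.CChan) (e : Exp L m) (P : Proc L m k) : Proc L m k
  | qin {m k : ℕ} (c : L.QChan) (P : Proc L m (k + 1)) : Proc L m k
  | qout {m k : ℕ} (c : L.QChan) (q : QRef k) (P : Proc L m k) : Proc L m k
  | oper {m k n : ℕ} (E : SuperOp n) (q : Fin n → QRef k) (P : Proc L m k) : Proc L m k
  | meas {m k n : ℕ} (M : Measurement n) (q : Fin n → QRef k) (P : Proc L (m + 1) k) : Proc L m k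
  | sum {m k : ℕ} (P Q : Proc L m k) : Proc L m k
  | par {m k : ℕ} (P Q : Proc L m k) : Proc L m k
  | relabel {m k : ℕ} (P : Proc L m k) (f : Relabelling L) : Proc L m k
  | res {m k : ℕ} (P : Proc L m k) (S : Set (L.CChan ⊕ L.QChan)) : Proc L m k
  | ite {m k : ℕ} (b : BExp L m) (P : Proc L m k) : Proc L m k
  | const {m k : ℕ} (A : L.Const) (q : Fin (L.nq A) → QRef k) (x : Fin (L.nc A) → CArg m) :
      Proc L m k

/-- Weakening of a reference under one quantum binder. -/
def QRef.weaken {k : ℕ} : QRef k → QRef (k + 1) := Sum.map id Fin.succ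

/-- A renaming of references under one quantum binder. -/
def QRef.under {k k' : ℕ} (s : QRef k → QRef k') : QRef (k + 1) → QRef (k' + 1) :=
  Sum.elim (fun x => (s (.inl x)).weaken) (Fin.cases (.inr 0) fun i => (s (.inr i)).weaken)

/-- A classical substitution under one classical binder. -/
def CArg.under {m m' : ℕ} (s : Fin m → CArg m') : Fin (m + 1) → CArg (m' + 1) :=
  Fin.cases (.inl 0) fun i => Sum.map Fin.succ id (s i)

/-- Renaming of quantum variables. -/
def Proc.rename {L : Signature} {m k : ℕ} (P : Proc L m k) :
    {k' : ℕ} → (QRef k → QRef k') → Proc L m k' :=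
  match P with
  | .nil => fun _ => .nil
  | .tau P => fun s => .tau (P.rename s)
  | .cin c P => fun s => .cin c (P.rename s)
  | .cout c e P => fun s => .cout c e (P.rename s)
  | .qin c P => fun s => .qin c (P.rename (QRef.under s))
  | .qout c q P => fun s => .qout c (s q) (P.rename s)
  | .oper E q P => fun s => .oper E (fun i => s (q i)) (P.rename s)
  | .meas M q P => fun s => .meas M (fun i => s (q i)) (P.rename s)
  | .sum P Q => fun s => .sum (P.rename s) (Q.rename s)
  | .par P Q => fun s => .par (P.rename s) (Q.rename s)
  | .relabel P f => fun s => .relabel (P.rename s) f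
  | .res P S => fun s => .res (P.rename s) S
  | .ite b P => fun s => .ite b (P.rename s)
  | .const A q x => fun s => .const A (fun i => s (q i)) x

/-- Substitution for classical variables. -/
def Proc.subst {L : Signature} {m k : ℕ} (P : Proc L m k) :
    {m' : ℕ} → (Fin m → CArg m') → Proc L m' k :=
  match P with
  | .nil => fun _ => .nil
  | .tau P => fun s => .tau (P.subst s)
  | .cin c P => fun s => .cin c (P.subst (CArg.under s))
  | .cout c e P => fun s => .cout c (e.subst s) (P.subst s)
  | .qin c P => fun s => .qin c (P.subst s)
  | .qout c q P => fun s => .qout c q (P.subst s)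
  | .oper E q P => fun s => .oper E q (P.subst s)
  | .meas M q P => fun s => .meas M q (P.subst (CArg.under s))
  | .sum P Q => fun s => .sum (P.subst s) (Q.subst s)
  | .par P Q => fun s => .par (P.subst s) (Q.subst s)
  | .relabel P f => fun s => .relabel (P.subst s) f
  | .res P S => fun s => .res (P.subst s) S
  | .ite b P => fun s => .ite (b.subst s) (P.subst s)
  | .const A q x => fun s => .const A q fun i => Sum.elim s .inr (x i)

/-- `P[v/x]` for the only classical variable in scope. -/
def Proc.instC {L : Signature} (P : Proc L 1 0) (v : ℝ) : Proc L 0 0 :=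
  P.subst fun _ => .inr v

/-- `P[r/q]` for the only bound quantum variable in scope. -/
def Proc.instQ {L : Signature} (P : Proc L 0 1) (r : QVar) : Proc L 0 0 :=
  P.rename (Sum.elim .inl fun _ => .inl r)

/-- The quantum variables that occur in a term and are not bound inside it. -/
def Proc.refs {L : Signature} : {m k : ℕ} → Proc L m k → Set (QRef k)
  | _, _, .nil => ∅
  | _, _, .tau P => P.refs
  | _, _, .cin _ P => P.refs
  | _, _, .cout _ _ P => P.refs
  | _, _, .qin _ P => {q | q.weaken ∈ P.refs}
  | _, _, .qout _ q P => P.refs ∪ {q}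
  | _, _, .oper _ q P => P.refs ∪ Set.range q
  | _, _, .meas _ q P => P.refs ∪ Set.range q
  | _, _, .sum P Q => P.refs ∪ Q.refs
  | _, _, .par P Q => P.refs ∪ Q.refs
  | _, _, .relabel P _ => P.refs
  | _, _, .res P _ => P.refs
  | _, _, .ite _ P => P.refs
  | _, _, .const _ q _ => Set.range q

/-- The set `qv(P)` of free quantum variables. -/
def Proc.qv {L : Signature} {m k : ℕ} (P : Proc L m k) : Set QVar := {q | Sum.inl q ∈ P.refs}

/-- Legal terms: a quantum variable is not used after it has been sent, parallel components share
no quantum variable, and lists of quantum variables have no repetitions. -/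
def Proc.Legal {L : Signature} : {m k : ℕ} → Proc L m k → Prop
  | _, _, .nil => True
  | _, _, .tau P => P.Legal
  | _, _, .cin _ P => P.Legal
  | _, _, .cout _ _ P => P.Legal
  | _, _, .qin _ P => P.Legal
  | _, _, .qout _ q P => q ∉ P.refs ∧ P.Legal
  | _, _, .oper _ q P => Function.Injective q ∧ P.Legal
  | _, _, .meas _ q P => Function.Injective q ∧ P.Legal
  | _, _, .sum P Q => P.Legal ∧ Q.Legal
  | _, _, .par P Q => Disjoint P.refs Q.refs ∧ P.Legal ∧ Q.Legal
  | _, _, .relabel P _ => P.Legal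
  | _, _, .res P _ => P.Legal
  | _, _, .ite _ P => P.Legal
  | _, _, .const _ q _ => Function.Injective q

/-- The defining equations of the constants. The parameters of `A` are the `nc A` classical and the
`nq A` quantum variables in scope in its body, which has no other free variables. -/
structure Definitions (L : Signature) : Type where
  body : (A : L.Const) → Proc L (L.nc A) (L.nq A)
  legal : ∀ A, (body A).Legal
  closed : ∀ A, (body A).qv = ∅

/-- The body of `A` with variables `q` and values `v` for its parameters. -/
def Definitions.unfold {L : Signature} (D : Definitions L) (A : L.Const)
    (q : Fin (L.nq A) → QRef 0) (v : Fin (L.nc A) → CArg 0) : Proc L 0 0 :=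
  ((D.body A).subst v).rename (Sum.elim .inl q)

/-! ### Operational semantics -/

/-- Actions, including the invisible one. -/
inductive Act (L : Signature) : Type
  | tau
  | cin (c : L.CChan) (v : ℝ)
  | cout (c : L.CChan) (v : ℝ)
  | qin (c : L.QChan) (r : QVar)
  | qout (c : L.QChan) (r : QVar)

/-- The channel names of an action. -/
def Act.cn {L : Signature} : Act L → Set (L.CChan ⊕ L.QChan)
  | .tau => ∅
  | .cin c _ => {.inl c}
  | .cout c _ => {.inl c}
  | .qin c _ => {.inr c}
  | .qout c _ => {.inr c}

/-- The bound quantum variables of an action. -/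
def Act.qbv {L : Signature} : Act L → Set QVar
  | .qin _ r => {r}
  | _ => ∅

def Act.relabel {L : Signature} (f : Relabelling L) : Act L → Act L
  | .tau => .tau
  | .cin c v => .cin (f.onC c) v
  | .cout c v => .cout (f.onC c) v
  | .qin c r => .qin (f.onQ c) r
  | .qout c r => .qout (f.onQ c) r

/-- A closed term with a state of the environment. -/
abbrev RawCon (L : Signature) : Type := Proc L 0 0 × Density

/-- The transitions of closed terms. -/
inductive RawStep {L : Signature} (D : Definitions L) :
    RawCon L → Act L → PMF (RawCon L) → Prop
  | tau (P : Proc L 0 0) (ρ : Density) : RawStep D (.tau P, ρ) .tau (.pure (P, ρ))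
  | cin (c : L.CChan) (P : Proc L 1 0) (ρ : Density) (v : ℝ) :
      RawStep D (.cin c P, ρ) (.cin c v) (.pure (P.instC v, ρ))
  | cout (c : L.CChan) (e : Exp L 0) (P : Proc L 0 0) (ρ : Density) :
      RawStep D (.cout c e P, ρ) (.cout c e.eval) (.pure (P, ρ))
  | ccomL {c : L.CChan} {v : ℝ} {P₁ P₂ Q₁ Q₂ : Proc L 0 0} {ρ : Density} :
      RawStep D (P₁, ρ) (.cin c v) (.pure (Q₁, ρ)) →
      RawStep D (P₂, ρ) (.cout c v) (.pure (Q₂, ρ)) →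
      RawStep D (.par P₁ P₂, ρ) .tau (.pure (.par Q₁ Q₂, ρ))
  | ccomR {c : L.CChan} {v : ℝ} {P₁ P₂ Q₁ Q₂ : Proc L 0 0} {ρ : Density} :
      RawStep D (P₁, ρ) (.cout c v) (.pure (Q₁, ρ)) →
      RawStep D (P₂, ρ) (.cin c v) (.pure (Q₂, ρ)) →
      RawStep D (.par P₁ P₂, ρ) .tau (.pure (.par Q₁ Q₂, ρ))
  | qin (c : L.QChan) (P : Proc L 0 1) (ρ : Density) (r : QVar) :
      r ∉ (Proc.qin c P).qv → RawStep D (.qin c P, ρ) (.qin c r) (.pure (P.instQ r, ρ))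
  | qout (c : L.QChan) (q : QVar) (P : Proc L 0 0) (ρ : Density) :
      RawStep D (.qout c (.inl q) P, ρ) (.qout c q) (.pure (P, ρ))
  | qcomL {c : L.QChan} {r : QVar} {P₁ P₂ Q₁ Q₂ : Proc L 0 0} {ρ : Density} :
      RawStep D (P₁, ρ) (.qin c r) (.pure (Q₁, ρ)) →
      RawStep D (P₂, ρ) (.qout c r) (.pure (Q₂, ρ)) →
      RawStep D (.par P₁ P₂, ρ) .tau (.pure (.par Q₁ Q₂, ρ))
  | qcomR {c : L.QChan} {r : QVar} {P₁ P₂ Q₁ Q₂ : Proc L 0 0} {ρ : Density} :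
      RawStep D (P₁, ρ) (.qout c r) (.pure (Q₁, ρ)) →
      RawStep D (P₂, ρ) (.qin c r) (.pure (Q₂, ρ)) →
      RawStep D (.par P₁ P₂, ρ) .tau (.pure (.par Q₁ Q₂, ρ))
  | oper {n : ℕ} (E : SuperOp n) (q : Fin n ↪ QVar) (P : Proc L 0 0) (ρ ρ' : Density) :
      ρ'.op = E.applyAt q ρ.op →
      RawStep D (.oper E (fun i => .inl (q i)) P, ρ) .tau (.pure (P, ρ'))
  | meas {n : ℕ} (M : Measurement n) (q : Fin n ↪ QVar) (P : Proc L 1 0) (ρ : Density)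
      (p : PMF (Bits n)) (ρ' : Bits n → Density) :
      (∀ i, p i = ENNReal.ofReal (tr (opAt q (M.proj i) ∘L ρ.op)).re) →
      (∀ i, p i ≠ 0 → (ρ' i).op =
        ((p i).toReal : ℂ)⁻¹ • (opAt q (M.proj i) ∘L ρ.op ∘L opAt q (M.proj i))) →
      RawStep D (.meas M (fun i => .inl (q i)) P, ρ) .tau
        (p.map fun i => (P.instC (M.herm.eigenvalues i), ρ' i))
  | parL {P Q : Proc L 0 0} {ρ : Density} {α : Act L} {Δ : PMF (RawCon L)} :
      RawStep D (P, ρ) α Δ → Disjoint α.qbv Q.qv →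
      RawStep D (.par P Q, ρ) α (Δ.map fun C => (.par C.1 Q, C.2))
  | parR {P Q : Proc L 0 0} {ρ : Density} {α : Act L} {Δ : PMF (RawCon L)} :
      RawStep D (Q, ρ) α Δ → Disjoint α.qbv P.qv →
      RawStep D (.par P Q, ρ) α (Δ.map fun C => (.par P C.1, C.2))
  | sumL {P Q : Proc L 0 0} {ρ : Density} {α : Act L} {Δ : PMF (RawCon L)} :
      RawStep D (P, ρ) α Δ → RawStep D (.sum P Q, ρ) α Δ
  | sumR {P Q : Proc L 0 0} {ρ : Density} {α : Act L} {Δ : PMF (RawCon L)} :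
      RawStep D (Q, ρ) α Δ → RawStep D (.sum P Q, ρ) α Δ
  | relabel {P : Proc L 0 0} {ρ : Density} {α : Act L} {Δ : PMF (RawCon L)} (f : Relabelling L) :
      RawStep D (P, ρ) α Δ →
      RawStep D (.relabel P f, ρ) (α.relabel f) (Δ.map fun C => (.relabel C.1 f, C.2))
  | res {P : Proc L 0 0} {ρ : Density} {α : Act L} {Δ : PMF (RawCon L)}
      (S : Set (L.CChan ⊕ L.QChan)) :
      RawStep D (P, ρ) α Δ → Disjoint α.cn S →
      RawStep D (.res P S, ρ) α (Δ.map fun C => (.res C.1 S, C.2))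
  | ite {P : Proc L 0 0} {ρ : Density} {α : Act L} {Δ : PMF (RawCon L)} (b : BExp L 0) :
      RawStep D (P, ρ) α Δ → b.holds → RawStep D (.ite b P, ρ) α Δ
  | const (A : L.Const) (q : Fin (L.nq A) → QRef 0) (v : Fin (L.nc A) → CArg 0)
      {ρ : Density} {α : Act L} {Δ : PMF (RawCon L)} :
      RawStep D (D.unfold A q v, ρ) α Δ → RawStep D (.const A q v, ρ) α Δ

/-- Configurations: a closed legal term with a density operator. -/
structure Con (L : Signature) : Type where
  proc : Proc L 0 0
  legal : proc.Legal
  state : Density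

def Con.raw {L : Signature} (C : Con L) : RawCon L := (C.proc, C.state)

/-- The free quantum variables of a configuration. -/
def Con.qv {L : Signature} (C : Con L) : Set QVar := C.proc.qv

/-- The configuration `E(C)`. -/
def Con.apply {L : Signature} (E : Density → Density) (C : Con L) : Con L :=
  { C with state := E C.state }

/-- The transitions between configurations and distributions of configurations. -/
def Step {L : Signature} (D : Definitions L) (α : Act L) (C : Con L) (Δ : PMF (Con L)) : Prop :=
  RawStep D C.raw α (Δ.map Con.raw)

/-! ### Lifting and weak transitions -/

/-- The lifting of a relation between states and distributions to distributions. -/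
inductive Lift {S : Type} (R : S → PMF S → Prop) : PMF S → PMF S → Prop
  | point {s : S} {Θ : PMF S} : R s Θ → Lift R (.pure s) Θ
  | linear {n : ℕ} (p : PMF (Fin n)) (Δ Θ : Fin n → PMF S) :
      (∀ i, Lift R (Δ i) (Θ i)) → Lift R (p.bind Δ) (p.bind Θ)

/-- The lifting of a relation between states to distributions. -/
def LiftRel {S : Type} (R : S → S → Prop) : PMF S → PMF S → Prop :=
  Lift fun s Θ => ∃ t, R s t ∧ Θ = PMF.pure t

/-- One step, or for the invisible action possibly none. -/
def HatStep {L : Signature} (D : Definitions L) (α : Act L) (C : Con L) (Δ : PMF (Con L)) : Prop :=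
  Step D α C Δ ∨ (α = .tau ∧ Δ = PMF.pure C)

/-- Finitely many lifted invisible steps. -/
def WeakTau {L : Signature} (D : Definitions L) : PMF (Con L) → PMF (Con L) → Prop :=
  Relation.ReflTransGen (Lift (HatStep D .tau))

/-- Weak transitions. -/
def Weak {L : Signature} (D : Definitions L) (α : Act L) (Δ Θ : PMF (Con L)) : Prop :=
  (α = .tau ∧ WeakTau D Δ Θ) ∨
    (α ≠ .tau ∧ ∃ Δ₁ Δ₂, WeakTau D Δ Δ₁ ∧ Lift (HatStep D α) Δ₁ Δ₂ ∧ WeakTau D Δ₂ Θ)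

/-! ### Open bisimilarity -/

/-- Weak open simulations. The equation between reduced operators says `ptr(C) = ptr(C')`: the
partial traces of the two states over `qv(C) = qv(C')` agree. -/
def IsOpenSimulation {L : Signature} (D : Definitions L) (R : Con L → Con L → Prop) : Prop :=
  ∀ C C', R C C' →
    C.qv = C'.qv ∧
    reduced C.qvᶜ C.state.op = reduced C.qvᶜ C'.state.op ∧
    ∀ E : Density → Density, IsSuperOpOn C.qvᶜ E → ∀ (α : Act L) (Δ : PMF (Con L)),
      Step D α (C.apply E) Δ →
      ∃ Θ, Weak D α (PMF.pure (C'.apply E)) Θ ∧ LiftRel R Δ Θ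

def IsOpenBisimulation {L : Signature} (D : Definitions L) (R : Con L → Con L → Prop) : Prop :=
  IsOpenSimulation D R ∧ IsOpenSimulation D fun C C' => R C' C

/-- Open bisimilarity, the union of all open bisimulations. -/
def OpenBisimilar {L : Signature} (D : Definitions L) (C C' : Con L) : Prop :=
  ∃ R, IsOpenBisimulation D R ∧ R C C'

/-! ### The logic -/

/-- Configuration formulae. A distribution formula, a finite probabilistic choice of configuration
formulae, only occurs under a diamond, so that the two are one constructor `diam`. -/
inductive Formula (L : Signature) : Type 1
  | atom {n : ℕ} (E : Projector n) (q : Fin n ↪ QVar) (p : ℝ)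
  | conj (I : Type) (φ : I → Formula L)
  | diam (α : Act L) {n : ℕ} (p : PMF (Fin n)) (φ : Fin n → Formula L)
  | neg (φ : Formula L)
  | sop (E : EnvSuperOp) (φ : Formula L)

/-- Satisfaction. -/
def Sat {L : Signature} (D : Definitions L) : Formula L → Con L → Prop
  | .atom E q p, C => Disjoint C.qv (Set.range q) ∧ p ≤ (tr (opAt q E.1 ∘L C.state.op)).re
  | .conj _ φ, C => ∀ i, Sat D (φ i) C
  | .diam α p φ, C => ∃ Δ, Weak D α (PMF.pure C) Δ ∧
      ∃ Δs : Fin _ → PMF (Con L), Δ = p.bind Δs ∧ ∀ i, ∀ C' ∈ (Δs i).support, Sat D (φ i) C'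
  | .neg φ, C => ¬ Sat D φ C
  | .sop E φ, C => IsSuperOpOn C.qvᶜ E.1 ∧ Sat D φ (C.apply E.1)

/-- Two configurations satisfy the same formulae. -/
def LogicallyEquivalent {L : Signature} (D : Definitions L) (C C' : Con L) : Prop :=
  ∀ φ : Formula L, Sat D φ C ↔ Sat D φ C'

end QCCS

end

namespace QCCS

/-! ### Finitely supported distributions -/

/-! Bisimilarity implies logical equivalence by induction on the formula. An atom constrains only
qubits outside `qv`, where its expectation value is a function of the reduced state
(`tr_opAt_eq_of_reduced`). For a diamond, a simulation matches whole weak transitions of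
distributions (`IsOpenSimulation.weak`), and a lifted relation can be split along any finite mixture
of its left side (`Lift.split`); splitting rests on the kernel form of a lifting,
`Lift.exists_kernel`, obtained by Bayes' rule. For `𝓔.φ`, the closure of bisimilarity under
environment super-operators is again a bisimulation (`OpenBisimilar.apply`). This needs the reduced
state after `𝓔` to depend only on the reduced state before. Since the reduced state is an infinite
sum of blocks, `𝓔` has to commute with that sum: the image of a positive tail is positive with the
same trace, and the operator norm is at most the trace (`IsTracePreservingCP.hasSum`).

Conversely, logical equivalence is itself an open bisimulation. Atoms detect `qv`, and they
determine the reduced state: projectors determine a Hermitian matrix on finitely many qubits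
(`eq_of_re_trace_mul_eq`), and the reductions to finite sets of qubits determine the reduction to an
infinite one by dominated convergence (`reduced_eq_of_finite`). The modality `𝓔.φ` makes logical
equivalence stable under super-operators. For transitions, arbitrary conjunctions give each
configuration a characteristic formula (`exists_characteristic`). Steps have finite support, so one
diamond over characteristic formulae describes the target exactly, and the equivalent configuration
must have a matching weak transition. -/

theorem pmf_bind_congr {A B : Type} {p : PMF A} {f g : A → PMF B}
    (h : ∀ a, p a ≠ 0 → f a = g a) : p.bind f = p.bind g := by
  ext b
  simp only [PMF.bind_apply]
  refine tsum_congr fun a => ?_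
  by_cases ha : p a = 0
  · simp [ha]
  · rw [h a ha]

theorem pmf_support_bind_finite {A B : Type} {p : PMF A} {f : A → PMF B}
    (hp : p.support.Finite) (hf : ∀ a, p a ≠ 0 → (f a).support.Finite) :
    (p.bind f).support.Finite := by
  rw [PMF.support_bind]
  exact hp.biUnion fun a ha => hf a ((p.mem_support_iff a).1 ha)

/-- The indices of weight zero in a mixture can be redirected to indices of positive weight. -/
theorem exists_retraction {n : ℕ} (p : PMF (Fin n)) :
    ∃ r : Fin n → Fin n, (∀ i, p (r i) ≠ 0) ∧ ∀ i, p i ≠ 0 → r i = i := by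
  classical
  obtain ⟨i₀, h₀⟩ := p.support_nonempty
  rw [PMF.mem_support_iff] at h₀
  refine ⟨fun i => if p i = 0 then i₀ else i, fun i => ?_, fun i hi => by simp [hi]⟩
  by_cases hi : p i = 0 <;> simp [hi, h₀]

/-- Enumerating the support turns `p` into weights on some `Fin n`, the only mixtures that `Lift`
and the formulae allow. Quantifying over `f` lets both sides of a lifted relation be reindexed by
the same enumeration. -/
theorem pmf_exists_fin {A : Type} (p : PMF A) (hp : p.support.Finite) :
    ∃ (n : ℕ) (p' : PMF (Fin n)) (e : Fin n → A),
      (∀ j, p (e j) ≠ 0) ∧ ∀ {B : Type} (f : A → PMF B), p.bind f = p'.bind fun j => f (e j) := by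
  classical
  have : Fintype p.support := hp.fintype
  obtain ⟨a₀, h₀⟩ := p.support_nonempty
  let E := Fintype.equivFin p.support
  let g : A → Fin (Fintype.card p.support) :=
    fun a => if h : a ∈ p.support then E ⟨a, h⟩ else E ⟨a₀, h₀⟩
  refine ⟨_, p.map g, fun j => (E.symm j : A), fun j => (E.symm j).2, fun {B} f => ?_⟩
  rw [PMF.bind_map]
  refine pmf_bind_congr fun a ha => ?_
  simp [g, ha]

/-! ### Lifting -/

section Lifting

variable {S : Type} {R R' : S → PMF S → Prop}

theorem Lift.mono (h : ∀ s Θ, R s Θ → R' s Θ) {Δ Θ : PMF S} (hl : Lift R Δ Θ) : Lift R' Δ Θ := by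
  induction hl with
  | point hs => exact .point (h _ _ hs)
  | linear p Δ Θ _ ih => exact .linear p Δ Θ ih

theorem Lift.linear_of_ne_zero {n : ℕ} (p : PMF (Fin n)) (Δ Θ : Fin n → PMF S)
    (h : ∀ i, p i ≠ 0 → Lift R (Δ i) (Θ i)) : Lift R (p.bind Δ) (p.bind Θ) := by
  obtain ⟨r, hr, hr'⟩ := exists_retraction p
  rw [pmf_bind_congr (g := fun i => Δ (r i)) fun i hi => by rw [hr' i hi],
    pmf_bind_congr (f := Θ) (g := fun i => Θ (r i)) fun i hi => by rw [hr' i hi]]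
  exact .linear p _ _ fun i => h _ (hr i)

theorem Lift.bind {A : Type} (p : PMF A) (hp : p.support.Finite) (Δ Θ : A → PMF S)
    (h : ∀ a, p a ≠ 0 → Lift R (Δ a) (Θ a)) : Lift R (p.bind Δ) (p.bind Θ) := by
  obtain ⟨n, p', e, he, hb⟩ := pmf_exists_fin p hp
  rw [hb, hb]
  exact .linear _ _ _ fun j => h _ (he j)

theorem Lift.finite_left {Δ Θ : PMF S} (hl : Lift R Δ Θ) : Δ.support.Finite := by
  induction hl with
  | point hs => simp
  | linear p Δ Θ _ ih => exact pmf_support_bind_finite (Set.toFinite _) fun i _ => ih i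

theorem Lift.finite_right (h : ∀ s Θ, R s Θ → Θ.support.Finite) {Δ Θ : PMF S}
    (hl : Lift R Δ Θ) : Θ.support.Finite := by
  induction hl with
  | point hs => exact h _ _ hs
  | linear p Δ Θ _ ih => exact pmf_support_bind_finite (Set.toFinite _) fun i _ => ih i

/-- Bayes' rule: `w` is the conditional distribution of the index given the outcome `s`. -/
theorem exists_posterior {n : ℕ} (p : PMF (Fin n)) (Δ : Fin n → PMF S) (s : S)
    (hs : p.bind Δ s ≠ 0) :
    ∃ w : PMF (Fin n), ∀ i, p.bind Δ s * w i = p i * Δ i s := by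
  have e : p.bind Δ s = ∑' i, p i * Δ i s := PMF.bind_apply _ _ _
  have hfin : p.bind Δ s ≠ ⊤ := PMF.apply_ne_top _ _
  refine ⟨PMF.normalize (fun i => p i * Δ i s) (e ▸ hs) (e ▸ hfin), fun i => ?_⟩
  rw [PMF.normalize_apply, ← e, mul_comm, mul_assoc, ENNReal.inv_mul_cancel hs hfin, mul_one]

/-- A lifted relation is given by a kernel on the support of its left argument. -/
theorem Lift.exists_kernel {Δ Θ : PMF S} (hl : Lift R Δ Θ) :
    ∃ K : S → PMF S, Θ = Δ.bind K ∧ ∀ s, Δ s ≠ 0 → Lift R (.pure s) (K s) := by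
  classical
  induction hl with
  | @point s Θ hs =>
    refine ⟨fun _ => Θ, by simp, fun t ht => ?_⟩
    have : t = s := by
      by_contra h
      exact ht (by simp [h])
    exact this ▸ .point hs
  | linear p Δ Θ _ ih =>
    choose K hK hK' using ih
    -- At outcomes of mass zero there is no posterior, and the prior `p` serves as a default. The
    -- kernel at `s` averages the kernels of the components with the posterior weights.
    have hw : ∀ s, ∃ w : PMF (Fin _), p.bind Δ s ≠ 0 → ∀ i, p.bind Δ s * w i = p i * Δ i s := by
      intro s
      by_cases hs : p.bind Δ s = 0
      · exact ⟨p, fun h => absurd hs h⟩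
      · obtain ⟨w, h⟩ := exists_posterior p Δ s hs
        exact ⟨w, fun _ => h⟩
    choose w hw using hw
    refine ⟨fun s => (w s).bind fun i => K i s, ?_, fun s hs => ?_⟩
    · ext t
      rw [funext hK]
      simp only [PMF.bind_apply (p := p), PMF.bind_apply (p := p.bind Δ), PMF.bind_apply (p := Δ _),
        PMF.bind_apply (p := w _)]
      simp only [← ENNReal.tsum_mul_left]
      rw [ENNReal.tsum_comm]
      refine tsum_congr fun s => tsum_congr fun i => ?_
      rw [← PMF.bind_apply, ← mul_assoc, ← mul_assoc]
      by_cases hs : p.bind Δ s = 0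
      · have : p i * Δ i s = 0 := by
          rw [PMF.bind_apply, ENNReal.tsum_eq_zero] at hs
          exact hs i
        rw [this, hs]
        simp
      · rw [hw s hs]
    · have : Lift R ((w s).bind fun _ => PMF.pure s) ((w s).bind fun i => K i s) := by
        refine .linear_of_ne_zero _ _ _ fun i hi => hK' i s fun h0 => ?_
        have := hw s hs i
        rw [h0, mul_zero, mul_eq_zero] at this
        exact this.elim hs hi
      simpa using this

/-- Pushing each component `Δ i` through a kernel for the whole mixture decomposes `Θ` with the same
weights, even if the derivation of the lifting used another decomposition. -/
theorem Lift.split {n : ℕ} {p : PMF (Fin n)} {Δ : Fin n → PMF S} {Θ : PMF S}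
    (hl : Lift R (p.bind Δ) Θ) :
    ∃ Θs : Fin n → PMF S, Θ = p.bind Θs ∧ ∀ i, p i ≠ 0 → Lift R (Δ i) (Θs i) := by
  obtain ⟨K, rfl, hK⟩ := hl.exists_kernel
  have hmem : ∀ i s, p i ≠ 0 → Δ i s ≠ 0 → p.bind Δ s ≠ 0 := by
    intro i s hi hs h
    rw [PMF.bind_apply, ENNReal.tsum_eq_zero] at h
    exact (mul_ne_zero hi hs) (h i)
  refine ⟨fun i => (Δ i).bind K, PMF.bind_bind _ _ _, fun i hi => ?_⟩
  have hfin : (Δ i).support.Finite := hl.finite_left.subset fun s hs => hmem i s hi hs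
  have := Lift.bind (R := R) (Δ i) hfin PMF.pure K fun s hs => hK s (hmem i s hi hs)
  rwa [PMF.bind_pure] at this

theorem Lift.refl (h : ∀ s, R s (.pure s)) (Δ : PMF S) (hΔ : Δ.support.Finite) : Lift R Δ Δ := by
  have := Lift.bind (R := R) Δ hΔ PMF.pure PMF.pure fun s _ => .point (h s)
  rwa [PMF.bind_pure] at this

end Lifting

/-! ### Lifting of relations between states -/

section LiftRel

variable {S : Type} {R R' : S → S → Prop}

theorem LiftRel.mono (h : ∀ s t, R s t → R' s t) {Δ Θ : PMF S} (hl : LiftRel R Δ Θ) :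
    LiftRel R' Δ Θ :=
  Lift.mono (fun _ _ ⟨t, ht, e⟩ => ⟨t, h _ _ ht, e⟩) hl

theorem LiftRel.point {s t : S} (h : R s t) : LiftRel R (.pure s) (.pure t) :=
  Lift.point ⟨t, h, rfl⟩

theorem LiftRel.finite_right {Δ Θ : PMF S} (hl : LiftRel R Δ Θ) : Θ.support.Finite := by
  refine Lift.finite_right ?_ hl
  rintro s _ ⟨t, -, rfl⟩
  simp

theorem LiftRel.exists_of_mem_support {Δ Θ : PMF S} (hl : LiftRel R Δ Θ) :
    ∀ t ∈ Θ.support, ∃ s ∈ Δ.support, R s t := by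
  unfold LiftRel at hl
  induction hl with
  | point hs =>
    obtain ⟨t, ht, rfl⟩ := hs
    simpa using ht
  | linear p Δ Θ _ ih =>
    intro t ht
    obtain ⟨i, hi, hit⟩ := (PMF.mem_support_bind_iff _ _ _).1 ht
    obtain ⟨s, hs, hst⟩ := ih i t hit
    exact ⟨s, (PMF.mem_support_bind_iff _ _ _).2 ⟨i, hi, hs⟩, hst⟩

end LiftRel

/-! ### Weak transitions -/

variable {L : Signature} {D : Definitions L}

/-- Only measurements branch, and their outcomes are indexed by the finite type `Bits n`. -/
theorem RawStep.finite {C : RawCon L} {α : Act L} {Δ : PMF (RawCon L)} (h : RawStep D C α Δ) :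
    Δ.support.Finite := by
  induction h with
  | meas => simpa using Set.toFinite _
  | parL _ _ ih => simpa using ih.image _
  | parR _ _ ih => simpa using ih.image _
  | relabel _ _ ih => simpa using ih.image _
  | res _ _ _ ih => simpa using ih.image _
  | sumL _ ih => exact ih
  | sumR _ ih => exact ih
  | ite _ _ _ ih => exact ih
  | const _ _ _ _ ih => exact ih
  | _ => simp

theorem Con.raw_injective : Function.Injective (Con.raw : Con L → RawCon L) := by
  rintro ⟨P, hP, ρ⟩ ⟨Q, hQ, σ⟩ h
  obtain ⟨rfl, rfl⟩ := Prod.mk.inj h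
  rfl

theorem Step.finite {α : Act L} {C : Con L} {Δ : PMF (Con L)} (h : Step D α C Δ) :
    Δ.support.Finite := by
  have := RawStep.finite h
  rw [PMF.support_map] at this
  exact this.of_finite_image Con.raw_injective.injOn

theorem HatStep.finite {α : Act L} {C : Con L} {Δ : PMF (Con L)} (h : HatStep D α C Δ) :
    Δ.support.Finite := by
  rcases h with h | ⟨-, rfl⟩
  · exact h.finite
  · simp

theorem WeakTau.finite {Δ Θ : PMF (Con L)} (h : WeakTau D Δ Θ) (hΔ : Δ.support.Finite) :
    Θ.support.Finite := by
  induction h with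
  | refl => exact hΔ
  | tail _ h _ => exact Lift.finite_right (fun _ _ => HatStep.finite) h

theorem Weak.finite {α : Act L} {Δ Θ : PMF (Con L)} (h : Weak D α Δ Θ) (hΔ : Δ.support.Finite) :
    Θ.support.Finite := by
  rcases h with ⟨-, h⟩ | ⟨-, _, _, -, h₂, h₃⟩
  · exact h.finite hΔ
  · exact h₃.finite (Lift.finite_right (fun _ _ => HatStep.finite) h₂)

/-- The components may need different numbers of steps, so they are moved one at a time while the
others idle through the reflexive part of `HatStep`. Idling as a lifted step requires finite
support. The induction runs over the set of components already moved. -/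
theorem WeakTau.linear {n : ℕ} (p : PMF (Fin n)) (Δ Θ : Fin n → PMF (Con L))
    (hfin : ∀ i, (Δ i).support.Finite) (h : ∀ i, WeakTau D (Δ i) (Θ i)) :
    WeakTau D (p.bind Δ) (p.bind Θ) := by
  classical
  have key : ∀ s : Finset (Fin n), WeakTau D (p.bind Δ)
      (p.bind fun i => if i ∈ s then Θ i else Δ i) := by
    intro s
    induction s using Finset.induction_on with
    | empty => exact Relation.ReflTransGen.refl
    | insert a s ha ih =>
      refine ih.trans ?_
      set g : Fin n → PMF (Con L) := fun i => if i ∈ s then Θ i else Δ i with hg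
      have hgfin : ∀ i, (g i).support.Finite := by
        intro i
        by_cases hi : i ∈ s
        · simpa [hg, hi] using (h i).finite (hfin i)
        · simpa [hg, hi] using hfin i
      have step := Relation.ReflTransGen.lift (r := Lift (HatStep D .tau))
        (p := Lift (HatStep D .tau)) (fun X => p.bind (Function.update g a X))
        (fun X Y hXY => Lift.linear p _ _ fun i => by
          by_cases hi : i = a
          · subst hi
            simpa using hXY
          · simpa [hi] using Lift.refl (fun s => Or.inr ⟨rfl, rfl⟩) _ (hgfin i)) _ _ (h a)
      have e₁ : Function.update g a (Δ a) = g := by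
        rw [Function.update_eq_self_iff]
        simp [hg, ha]
      have e₂ : Function.update g a (Θ a) = fun i => if i ∈ insert a s then Θ i else Δ i := by
        funext i
        by_cases hi : i = a
        · subst hi
          simp
        · simp [hi, hg]
      simp only [Function.onFun, e₁, e₂] at step
      exact step
  simpa using key Finset.univ

theorem Weak.linear {α : Act L} {n : ℕ} (p : PMF (Fin n)) (Δ Θ : Fin n → PMF (Con L))
    (hfin : ∀ i, p i ≠ 0 → (Δ i).support.Finite) (h : ∀ i, p i ≠ 0 → Weak D α (Δ i) (Θ i)) :
    Weak D α (p.bind Δ) (p.bind Θ) := by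
  obtain ⟨r, hr, hr'⟩ := exists_retraction p
  rw [pmf_bind_congr (g := fun i => Δ (r i)) fun i hi => by rw [hr' i hi],
    pmf_bind_congr (f := Θ) (g := fun i => Θ (r i)) fun i hi => by rw [hr' i hi]]
  replace h := fun i => h _ (hr i)
  replace hfin := fun i => hfin _ (hr i)
  by_cases hα : α = .tau
  · exact .inl ⟨hα, .linear p _ _ hfin fun i => by simpa [Weak, hα] using h i⟩
  · have h' : ∀ i, ∃ Δ₁ Δ₂, WeakTau D (Δ (r i)) Δ₁ ∧ Lift (HatStep D α) Δ₁ Δ₂ ∧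
        WeakTau D Δ₂ (Θ (r i)) := fun i => by simpa [Weak, hα] using h i
    choose Δ₁ Δ₂ h₁ h₂ h₃ using h'
    exact .inr ⟨hα, p.bind Δ₁, p.bind Δ₂, .linear p _ _ hfin h₁, .linear p _ _ h₂,
      .linear p _ _ (fun i => Lift.finite_right (fun _ _ => HatStep.finite) (h₂ i)) h₃⟩

theorem WeakTau.trans_weak {α : Act L} {Δ Δ' Θ : PMF (Con L)} (h : WeakTau D Δ Δ')
    (h' : Weak D α Δ' Θ) : Weak D α Δ Θ := by
  rcases h' with ⟨hα, h₁⟩ | ⟨hα, _, _, h₁, h₂, h₃⟩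
  · exact .inl ⟨hα, Relation.ReflTransGen.trans h h₁⟩
  · exact .inr ⟨hα, _, _, Relation.ReflTransGen.trans h h₁, h₂, h₃⟩

theorem Weak.trans_weakTau {α : Act L} {Δ Δ' Θ : PMF (Con L)} (h' : Weak D α Δ Δ')
    (h : WeakTau D Δ' Θ) : Weak D α Δ Θ := by
  rcases h' with ⟨hα, h₁⟩ | ⟨hα, _, _, h₁, h₂, h₃⟩
  · exact .inl ⟨hα, Relation.ReflTransGen.trans h₁ h⟩
  · exact .inr ⟨hα, _, _, h₁, h₂, Relation.ReflTransGen.trans h₃ h⟩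

theorem Weak.weakTau {Δ Θ : PMF (Con L)} (h : Weak D .tau Δ Θ) : WeakTau D Δ Θ := by
  simpa [Weak] using h

theorem Step.weak {α : Act L} {C : Con L} {Δ : PMF (Con L)} (h : Step D α C Δ) :
    Weak D α (.pure C) Δ := by
  have hl : Lift (HatStep D α) (.pure C) Δ := .point (.inl h)
  by_cases hα : α = .tau
  · subst hα
    exact .inl ⟨rfl, .single hl⟩
  · exact .inr ⟨hα, _, _, .refl, hl, .refl⟩

/-! ### Weak transitions are simulated -/

theorem isSuperOpOn_id (V : Set QVar) : IsSuperOpOn V id :=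
  ⟨LinearMap.id, ⟨fun _ _ h _ => h, fun _ _ hs => hs.hasSum⟩, fun _ _ _ => rfl⟩

section Simulation

variable {R : Con L → Con L → Prop}

-- The identity super-operator recovers the ordinary simulation clause.
theorem IsOpenSimulation.hatStep (hR : IsOpenSimulation D R) {α : Act L} {C C' : Con L}
    {Δ : PMF (Con L)} (h : R C C') (hs : HatStep D α C Δ) :
    ∃ Θ, Weak D α (.pure C') Θ ∧ LiftRel R Δ Θ := by
  rcases hs with hs | ⟨hα, rfl⟩
  · exact (hR C C' h).2.2 id (isSuperOpOn_id _) α Δ hs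
  · exact ⟨_, .inl ⟨hα, .refl⟩, .point h⟩

/-- A lifted step from a point may be a mixture of different steps of the same configuration. Each
is answered from `C'`, and the answers recombine because a mixture of copies of the point
distribution at `C'` is that point distribution. Allowing any `Δ` whose support is related to `C'`
makes the induction on the lifting go through. -/
theorem IsOpenSimulation.liftHatStep_pure (hR : IsOpenSimulation D R) {α : Act L} {C' : Con L}
    {Δ Δ' : PMF (Con L)} (hs : Lift (HatStep D α) Δ Δ') (h : ∀ C, Δ C ≠ 0 → R C C') :
    ∃ Θ, Weak D α (.pure C') Θ ∧ LiftRel R Δ' Θ := by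
  classical
  induction hs with
  | @point C Δ' hs => exact hR.hatStep (h C (by simp)) hs
  | linear p Δ Δ' _ ih =>
    have : Nonempty (PMF (Con L)) := ⟨.pure C'⟩
    have ih' : ∀ i, p i ≠ 0 → ∃ Θ, Weak D α (.pure C') Θ ∧ LiftRel R (Δ' i) Θ := by
      refine fun i hi => ih i fun C hC => h C ?_
      rw [← PMF.mem_support_iff, PMF.mem_support_bind_iff]
      exact ⟨i, hi, hC⟩
    choose! Θ hΘ hΘ' using ih'
    have hw := Weak.linear p (fun _ => PMF.pure C') Θ (fun _ _ => by simp) hΘ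
    rw [PMF.bind_const] at hw
    exact ⟨p.bind Θ, hw, Lift.linear_of_ne_zero p _ _ hΘ'⟩

theorem IsOpenSimulation.liftHatStep (hR : IsOpenSimulation D R) {α : Act L}
    {Δ Δ' Θ : PMF (Con L)} (h : LiftRel R Δ Θ) (hs : Lift (HatStep D α) Δ Δ') :
    ∃ Θ', Weak D α Θ Θ' ∧ LiftRel R Δ' Θ' := by
  classical
  unfold LiftRel at h
  induction h generalizing Δ' with
  | @point C Θ hC =>
    obtain ⟨C', hC', rfl⟩ := hC
    refine hR.liftHatStep_pure hs fun C₁ h₁ => ?_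
    have : C₁ = C := by
      by_contra h
      exact h₁ (by simp [h])
    rwa [this]
  | linear p Δ Θ hl ih =>
    have : Nonempty (PMF (Con L)) := ⟨Δ'⟩
    obtain ⟨Δs, rfl, hΔs⟩ := hs.split
    have ih' := fun i hi => ih i (hΔs i hi)
    choose! Θ' hw hl' using ih'
    exact ⟨p.bind Θ', .linear p _ _ (fun i _ => LiftRel.finite_right (hl i)) hw,
      Lift.linear_of_ne_zero p _ _ hl'⟩

theorem IsOpenSimulation.weakTau (hR : IsOpenSimulation D R)
    {Δ Δ' Θ : PMF (Con L)} (h : LiftRel R Δ Θ) (hs : WeakTau D Δ Δ') :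
    ∃ Θ', WeakTau D Θ Θ' ∧ LiftRel R Δ' Θ' := by
  induction hs with
  | refl => exact ⟨Θ, .refl, h⟩
  | tail _ hs ih =>
    obtain ⟨Θ₁, h₁, hl₁⟩ := ih
    obtain ⟨Θ₂, h₂, hl₂⟩ := hR.liftHatStep hl₁ hs
    exact ⟨Θ₂, Relation.ReflTransGen.trans h₁ h₂.weakTau, hl₂⟩

theorem IsOpenSimulation.weak (hR : IsOpenSimulation D R) {α : Act L}
    {Δ Δ' Θ : PMF (Con L)} (h : LiftRel R Δ Θ) (hs : Weak D α Δ Δ') :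
    ∃ Θ', Weak D α Θ Θ' ∧ LiftRel R Δ' Θ' := by
  rcases hs with ⟨hα, hs⟩ | ⟨-, _, _, h₁, h₂, h₃⟩
  · obtain ⟨Θ', h', hl⟩ := hR.weakTau h hs
    exact ⟨Θ', .inl ⟨hα, h'⟩, hl⟩
  · obtain ⟨Θ₁, w₁, l₁⟩ := hR.weakTau h h₁
    obtain ⟨Θ₂, w₂, l₂⟩ := hR.liftHatStep l₁ h₂
    obtain ⟨Θ₃, w₃, l₃⟩ := hR.weakTau l₂ h₃
    exact ⟨Θ₃, (w₁.trans_weak w₂).trans_weakTau w₃, l₃⟩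

end Simulation

/-! ### Matrix entries of operators -/

section Entries

variable {ι κ : Type}

/-- The matrix entry `⟨i|T|j⟩`. -/
noncomputable def entry (T : Op ι) (i j : ι) : ℂ := ⟪ket i, T (ket j)⟫_ℂ

theorem diagEntry_eq (T : Op ι) (i : ι) : diagEntry T i = entry T i i := rfl

theorem inner_ket (i : ι) (w : Hilb ι) : ⟪ket i, w⟫_ℂ = w i := by
  classical
  simp [ket, lp.inner_single_left]

theorem hilb_ext {w w' : Hilb ι} (h : ∀ i, ⟪ket i, w⟫_ℂ = ⟪ket i, w'⟫_ℂ) : w = w' := by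
  ext i
  rw [← inner_ket, ← inner_ket, h]

theorem inner_ket_ket [DecidableEq ι] (i j : ι) :
    ⟪(ket i : Hilb ι), ket j⟫_ℂ = if i = j then 1 else 0 :=
  orthonormal_iff_ite.1 orthonormal_ket i j

theorem dense_span_ket : Dense (Submodule.span ℂ (Set.range (ket : ι → Hilb ι)) : Set (Hilb ι)) := by
  classical
  have h := (default : HilbertBasis ι ℂ (Hilb ι)).dense_span
  have e : ((default : HilbertBasis ι ℂ (Hilb ι)) : ι → Hilb ι) = ket := by
    funext i
    exact ((default : HilbertBasis ι ℂ (Hilb ι)).repr_symm_single i).symm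
  rw [e] at h
  exact Submodule.dense_iff_topologicalClosure_eq_top.2 h

theorem op_ext {S T : Op ι} (h : ∀ i j, entry S i j = entry T i j) : S = T := by
  refine ContinuousLinearMap.ext_on dense_span_ket ?_
  rintro _ ⟨j, rfl⟩
  exact hilb_ext fun i => h i j

theorem hasSum_norm_sq (w : Hilb ι) : HasSum (fun i => ‖⟪ket i, w⟫_ℂ‖ ^ 2) (‖w‖ ^ 2) := by
  have h := lp.hasSum_norm (p := 2) (by norm_num) w
  simp only [inner_ket]
  simpa using h

theorem hasSum_entry {A : κ → Op ι} {S : Op ι} (h : HasSum A S) (i j : ι) :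
    HasSum (fun k => entry (A k) i j) (entry S i j) :=
  h.mapL ((innerSL ℂ (ket i : Hilb ι)) ∘L (ContinuousLinearMap.apply ℂ (Hilb ι) (ket j)))

theorem hasSum_inner_apply {A : κ → Op ι} {S : Op ι} (h : HasSum A S) (x : Hilb ι) :
    HasSum (fun k => ⟪x, A k x⟫_ℂ) ⟪x, S x⟫_ℂ :=
  h.mapL ((innerSL ℂ x) ∘L (ContinuousLinearMap.apply ℂ (Hilb ι) x))

theorem entry_sub (S T : Op ι) (i j : ι) : entry (S - T) i j = entry S i j - entry T i j := by
  simp [entry]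

theorem entry_sum (s : Finset κ) (A : κ → Op ι) (i j : ι) :
    entry (∑ k ∈ s, A k) i j = ∑ k ∈ s, entry (A k) i j := by
  simp [entry]

/-! ### Positive operators -/

theorem isPositive_iff_inner_nonneg (T : Op ι) : T.IsPositive ↔ ∀ x, 0 ≤ ⟪x, T x⟫_ℂ := by
  refine ⟨fun h x => h.inner_nonneg_right x, fun h => ?_⟩
  rw [ContinuousLinearMap.isPositive_iff_complex]
  intro x
  have hx : 0 ≤ ⟪T x, x⟫_ℂ := by
    rw [← inner_conj_symm]
    exact star_nonneg_iff.2 (h x)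
  obtain ⟨h₁, h₂⟩ := Complex.le_def.1 hx
  exact ⟨Complex.ext (by simp) (by simpa using h₂), by simpa using h₁⟩

theorem exists_sqrt {H : Type} [NormedAddCommGroup H]
    [InnerProductSpace ℂ H] [CompleteSpace H] {A : H →L[ℂ] H} (hA : A.IsPositive) :
    ∃ B : H →L[ℂ] H, A = B * B ∧ ∀ x y, ⟪x, B y⟫_ℂ = ⟪B x, y⟫_ℂ := by
  have h0 : 0 ≤ A := A.nonneg_iff_isPositive.2 hA
  refine ⟨CFC.sqrt A, (CFC.sqrt_mul_sqrt_self A h0).symm, fun x y => ?_⟩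
  have hB : (CFC.sqrt A).IsPositive :=
    (ContinuousLinearMap.nonneg_iff_isPositive _).1 (CFC.sqrt_nonneg A)
  exact (hB.isSymmetric x y).symm

theorem entry_conj {A : Op ι} (hA : A.IsPositive) (i j : ι) :
    (starRingEnd ℂ) (entry A i j) = entry A j i := by
  unfold entry
  rw [inner_conj_symm]
  exact hA.isSymmetric _ _

/-- Cauchy–Schwarz for the Gram matrix of the vectors `B (ket i)`, where `A = B * B`. This supplies
the dominating function in `reduced_eq_of_finite`. -/
theorem norm_entry_le {A : Op ι} (hA : A.IsPositive) (i j : ι) :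
    ‖entry A i j‖ ≤ ‖entry A i i‖ + ‖entry A j j‖ := by
  obtain ⟨B, rfl, hB⟩ := exists_sqrt hA
  have e : ∀ k l, entry (B * B) k l = ⟪B (ket k), B (ket l)⟫_ℂ := fun k l => hB _ _
  have h := norm_inner_le_norm (𝕜 := ℂ) (B (ket i)) (B (ket j))
  rw [e, e, e, inner_self_eq_norm_sq_to_K, inner_self_eq_norm_sq_to_K]
  simp only [norm_pow, Complex.coe_algebraMap, Complex.norm_real, norm_norm]
  nlinarith [sq_nonneg (‖B (ket i)‖ - ‖B (ket j)‖), sq_nonneg ‖B (ket i)‖, sq_nonneg ‖B (ket j)‖]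

/-- With `A = B * B` and `B` self-adjoint, the trace of `A` is the squared Hilbert–Schmidt norm of
`B`, which bounds the squared operator norm of `B`. -/
theorem norm_le_of_hasSum {A : Op ι} (hA : A.IsPositive) {t : ℂ} (ht : HasSum (diagEntry A) t) :
    ‖A‖ ≤ ‖t‖ := by
  obtain ⟨B, rfl, hB⟩ := exists_sqrt hA
  have e : ∀ k, diagEntry (B * B) k = ((‖B (ket k)‖ ^ 2 : ℝ) : ℂ) := fun k => by
    rw [diagEntry_eq]
    refine (hB _ _).trans ((inner_self_eq_norm_sq_to_K (𝕜 := ℂ) (B (ket k))).trans ?_)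
    simp
  have ht' : HasSum (fun k => ‖B (ket k)‖ ^ 2) t.re := by
    have := Complex.hasSum_re ht
    simpa only [e, Complex.ofReal_re] using this
  have h0 : 0 ≤ t.re := ht'.nonneg fun _ => sq_nonneg _
  have hb : ‖B‖ ≤ √t.re := by
    refine B.opNorm_le_bound (Real.sqrt_nonneg _) fun x => ?_
    rw [← sq_le_sq₀ (norm_nonneg _) (by positivity)]
    rw [mul_pow, Real.sq_sqrt h0]
    refine hasSum_le (fun j => ?_) (hasSum_norm_sq (B x)) (ht'.mul_right (‖x‖ ^ 2))
    rw [hB, ← mul_pow]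
    gcongr
    exact norm_inner_le_norm _ _
  calc ‖B * B‖ ≤ ‖B‖ * ‖B‖ := norm_mul_le _ _
    _ ≤ √t.re * √t.re := by gcongr
    _ = t.re := Real.mul_self_sqrt h0
    _ ≤ ‖t‖ := Complex.re_le_norm t

/-! ### Completely positive trace-preserving maps -/

theorem IsPosArray.isPositive {r : ℕ} {A : Fin r → Fin r → Op ι} (h : IsPosArray A) (i : Fin r) :
    (A i i).IsPositive := by
  rw [isPositive_iff_inner_nonneg]
  intro x
  have := h (Pi.single i x)
  rw [Finset.sum_eq_single i, Finset.sum_eq_single i] at this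
  · simpa using this
  · intro j _ hj
    simp [Pi.single_eq_of_ne hj]
  · simp
  · intro j _ hj
    simp [Pi.single_eq_of_ne hj]
  · simp

theorem IsTracePreservingCP.isPositive {F : Op ι →ₗ[ℂ] Op ι} (hF : IsTracePreservingCP F)
    {A : Op ι} (hA : A.IsPositive) (hs : Summable (diagEntry A)) : (F A).IsPositive := by
  refine (hF.cp 1 (fun _ _ => A) (fun x => ?_) fun _ => hs).isPositive 0
  simpa using hA.inner_nonneg_right (x 0)

theorem IsTracePreservingCP.comp {F F' : Op ι →ₗ[ℂ] Op ι} (hF' : IsTracePreservingCP F')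
    (hF : IsTracePreservingCP F) : IsTracePreservingCP (F' ∘ₗ F) where
  cp r A hA hs := hF'.cp r (fun i j => F (A i j)) (hF.cp r A hA hs) fun i =>
    (hF.tp _ (hA.isPositive i) (hs i)).summable
  tp A hA hs := by
    have h := hF.tp A hA hs
    have := hF'.tp _ (hF.isPositive hA hs) h.summable
    rwa [tr, h.tsum_eq] at this

theorem isPositive_sub_sum {A : κ → Op ι} {S : Op ι} (h : HasSum A S)
    (hA : ∀ k, (A k).IsPositive) (s : Finset κ) : (S - ∑ k ∈ s, A k).IsPositive := by
  rw [isPositive_iff_inner_nonneg]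
  intro x
  have := sum_le_hasSum s (fun k _ => (hA k).inner_nonneg_right x) (hasSum_inner_apply h x)
  simpa [inner_sub_right, inner_sum] using this

/-- A trace-preserving completely positive map is continuous for sums of positive operators
that converge in trace. -/
theorem IsTracePreservingCP.hasSum {F : Op ι →ₗ[ℂ] Op ι} (hF : IsTracePreservingCP F)
    {A : κ → Op ι} {S : Op ι} {t : ℂ} (h : HasSum A S) (hA : ∀ k, (A k).IsPositive)
    (hd : ∀ k, Summable (diagEntry (A k))) (hS : HasSum (diagEntry S) t)
    (ht : HasSum (fun k => tr (A k)) t) : HasSum (fun k => F (A k)) (F S) := by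
  unfold HasSum at ht ⊢
  -- The error is `F` of the positive remainder `S - ∑ A k`. Its norm is at most its trace, which
  -- `F` preserves, and the traces of the remainders tend to zero.
  rw [tendsto_iff_norm_sub_tendsto_zero] at ht ⊢
  refine squeeze_zero (fun _ => norm_nonneg _) (fun s => ?_) ht
  have hpos := isPositive_sub_sum h hA s
  have hdiag : HasSum (diagEntry (S - ∑ k ∈ s, A k)) (t - ∑ k ∈ s, tr (A k)) := by
    have e : diagEntry (S - ∑ k ∈ s, A k) = fun i => diagEntry S i - ∑ k ∈ s, diagEntry (A k) i := by
      funext i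
      simp only [diagEntry_eq, entry_sub, entry_sum]
    rw [e]
    exact hS.sub (hasSum_sum fun k _ => (hd k).hasSum)
  have h₁ := hF.tp _ hpos hdiag.summable
  rw [tr, hdiag.tsum_eq] at h₁
  have h₂ := norm_le_of_hasSum (hF.isPositive hpos hdiag.summable) h₁
  rw [norm_sub_rev, norm_sub_rev _ t]
  simpa using h₂

/-! ### Isometries that permute basis vectors -/

theorem basisIsometry_ket (v : κ → ι) (hv : Function.Injective v) (a : κ) :
    basisIsometry v hv (ket a) = ket (v a) := by
  classical
  unfold basisIsometry
  simp [ket, OrthogonalFamily.linearIsometry_apply_single]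

theorem adjoint_basisIsometry_ket (v : κ → ι) (hv : Function.Injective v) (a : κ) :
    (basisIsometry v hv).adjoint (ket (v a)) = ket a := by
  classical
  refine hilb_ext fun b => ?_
  rw [ContinuousLinearMap.adjoint_inner_right, basisIsometry_ket, inner_ket_ket, inner_ket_ket]
  simp [hv.eq_iff]

theorem adjoint_basisIsometry_ket_of_notMem (v : κ → ι) (hv : Function.Injective v) (i : ι)
    (hi : i ∉ Set.range v) : (basisIsometry v hv).adjoint (ket i) = 0 := by
  classical
  refine hilb_ext fun b => ?_
  rw [ContinuousLinearMap.adjoint_inner_right, basisIsometry_ket, inner_ket_ket, if_neg]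
  · simp
  · rintro rfl
    exact hi ⟨b, rfl⟩

end Entries

/-! ### Basis states of the environment and of subsystems -/

/-- The restriction of a basis state to the qubits in `U`. -/
noncomputable def restrictIdx (U : Set QVar) (i : EnvIdx) : SubIdx U :=
  Finsupp.subtypeDomain (fun x => x ∈ U) i

theorem restrictIdx_apply (U : Set QVar) (i : EnvIdx) (x : U) : restrictIdx U i x = i x := rfl

open Classical in
theorem joinIdx_apply (V : Set QVar) (a : SubIdx V) (k : SubIdx Vᶜ) (x : QVar) :
    joinIdx V a k x = if h : x ∈ V then a ⟨x, h⟩ else k ⟨x, h⟩ := by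
  split_ifs with h
  · exact joinIdx_of_mem a k ⟨x, h⟩
  · exact joinIdx_of_notMem a k ⟨x, h⟩

theorem restrictIdx_join (V : Set QVar) (a : SubIdx V) (k : SubIdx Vᶜ) :
    restrictIdx V (joinIdx V a k) = a := by
  ext x
  rw [restrictIdx_apply, joinIdx_of_mem]

theorem restrictIdx_compl_join (V : Set QVar) (a : SubIdx V) (k : SubIdx Vᶜ) :
    restrictIdx Vᶜ (joinIdx V a k) = k := by
  ext x
  rw [restrictIdx_apply, joinIdx_of_notMem]

theorem join_restrictIdx (V : Set QVar) (i : EnvIdx) :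
    joinIdx V (restrictIdx V i) (restrictIdx Vᶜ i) = i := by
  ext x
  rw [joinIdx_apply]
  split_ifs <;> rfl

theorem exists_restrictIdx_eq {V : Set QVar} (a : SubIdx V) : ∃ i, restrictIdx V i = a :=
  ⟨joinIdx V a 0, restrictIdx_join V a 0⟩

/-- A basis state of the environment is a basis state on `V` and one off `V`. -/
noncomputable def splitIdx (V : Set QVar) : SubIdx V × SubIdx Vᶜ ≃ EnvIdx where
  toFun x := joinIdx V x.1 x.2
  invFun i := (restrictIdx V i, restrictIdx Vᶜ i)
  left_inv x := by simp [restrictIdx_join, restrictIdx_compl_join]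
  right_inv i := join_restrictIdx V i

/-- The basis state `i`, with the qubits in `U` reset to their values in `a`. -/
noncomputable def resetIdx (U : Set QVar) (a i : EnvIdx) : EnvIdx :=
  joinIdx U (restrictIdx U a) (restrictIdx Uᶜ i)

open Classical in
theorem resetIdx_apply (U : Set QVar) (a i : EnvIdx) (x : QVar) :
    resetIdx U a i x = if x ∈ U then a x else i x := by
  rw [resetIdx, joinIdx_apply]
  split_ifs <;> rfl

/-! ### Reduced states -/

theorem entry_block (V : Set QVar) (T : Op EnvIdx) (k l : SubIdx Vᶜ) (a b : SubIdx V) :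
    entry (block V T k l) a b = entry T (joinIdx V a k) (joinIdx V b l) := by
  unfold entry block attach
  rw [ContinuousLinearMap.comp_apply, ContinuousLinearMap.adjoint_inner_right,
    ContinuousLinearMap.comp_apply, basisIsometry_ket, basisIsometry_ket]

theorem block_isPositive (V : Set QVar) {T : Op EnvIdx} (hT : T.IsPositive) (k : SubIdx Vᶜ) :
    (block V T k k).IsPositive :=
  hT.adjoint_conj (attach V k)

section Reduced

variable (V : Set QVar) (ρ : Density)

theorem Density.hasSum_split :
    HasSum (fun x : SubIdx V × SubIdx Vᶜ => diagEntry (block V ρ.op x.2 x.2) x.1) 1 := by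
  have h := (splitIdx V).hasSum_iff.2 ρ.trace_one
  have e : (fun x : SubIdx V × SubIdx Vᶜ => diagEntry (block V ρ.op x.2 x.2) x.1) =
      diagEntry ρ.op ∘ splitIdx V := by
    funext x
    exact entry_block V ρ.op x.2 x.2 x.1 x.1
  rwa [e]

theorem summable_diagEntry_block (k : SubIdx Vᶜ) :
    Summable (diagEntry (block V ρ.op k k)) :=
  (ρ.hasSum_split V).summable.comp_injective (i := fun a => (a, k)) fun _ _ h => (Prod.mk.inj h).1

theorem hasSum_tr_block : HasSum (fun k => tr (block V ρ.op k k)) 1 := by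
  have h := (Equiv.prodComm _ _).hasSum_iff.2 (ρ.hasSum_split V)
  exact h.prod_fiberwise fun k => (summable_diagEntry_block V ρ k).hasSum

/-- The blocks are positive, so their norms are bounded by their traces, which are summable. Without
this, the `tsum` defining `reduced` could be the default value zero. -/
theorem hasSum_block : HasSum (fun k => block V ρ.op k k) (reduced V ρ.op) := by
  refine Summable.hasSum (Summable.of_norm_bounded (hasSum_tr_block V ρ).summable.norm fun k => ?_)
  exact norm_le_of_hasSum (block_isPositive V ρ.positive k)
    (summable_diagEntry_block V ρ k).hasSum

theorem reduced_isPositive : (reduced V ρ.op).IsPositive := by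
  simpa using isPositive_sub_sum (hasSum_block V ρ) (fun k => block_isPositive V ρ.positive k) ∅

theorem hasSum_entry_reduced (a b : SubIdx V) :
    HasSum (fun k => entry ρ.op (joinIdx V a k) (joinIdx V b k)) (entry (reduced V ρ.op) a b) := by
  simpa only [entry_block] using hasSum_entry (hasSum_block V ρ) a b

theorem hasSum_diagEntry_reduced : HasSum (diagEntry (reduced V ρ.op)) 1 := by
  refine (ρ.hasSum_split V).prod_fiberwise fun a => ?_
  exact hasSum_entry (hasSum_block V ρ) a a

theorem reduced_eq_of_block {E : Density → Density} {F : Op (SubIdx V) →ₗ[ℂ] Op (SubIdx V)}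
    (hF : IsTracePreservingCP F)
    (hE : ∀ (ρ : Density) (k l : SubIdx Vᶜ), block V (E ρ).op k l = F (block V ρ.op k l)) :
    reduced V (E ρ).op = F (reduced V ρ.op) := by
  have h := hF.hasSum (hasSum_block V ρ) (fun k => block_isPositive V ρ.positive k)
    (summable_diagEntry_block V ρ) (hasSum_diagEntry_reduced V ρ) (hasSum_tr_block V ρ)
  simp only [← hE] at h
  exact (hasSum_block V (E ρ)).unique h

open Classical in
/-- Matrix entries of the reduced state, as sums over the basis states of the environment. -/
theorem hasSum_entry_reduced_restrict (a b : EnvIdx) :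
    HasSum (fun i => if restrictIdx V i = restrictIdx V b then entry ρ.op (resetIdx V a i) i else 0)
      (entry (reduced V ρ.op) (restrictIdx V a) (restrictIdx V b)) := by
  -- The basis states agreeing with `b` on `V` are exactly the joins of the restriction of `b` with
  -- some `k` off `V`.
  have hinj := joinIdx_right_injective V (restrictIdx V b)
  rw [← hinj.hasSum_iff]
  · convert hasSum_entry_reduced V ρ (restrictIdx V a) (restrictIdx V b) using 2 with k
    simp [restrictIdx_join, resetIdx, restrictIdx_compl_join]
  · intro i hi
    rw [if_neg]
    intro h
    refine hi ⟨restrictIdx Vᶜ i, ?_⟩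
    simp only [← h, join_restrictIdx]

end Reduced

theorem IsSuperOpOn.comp {V : Set QVar} {E E' : Density → Density} (hE' : IsSuperOpOn V E')
    (hE : IsSuperOpOn V E) : IsSuperOpOn V (E' ∘ E) := by
  obtain ⟨F, hF, h⟩ := hE
  obtain ⟨F', hF', h'⟩ := hE'
  exact ⟨F' ∘ₗ F, hF'.comp hF, fun ρ k l => by simp [h', h]⟩

theorem IsSuperOpOn.reduced_congr {V : Set QVar} {E : Density → Density} (hE : IsSuperOpOn V E)
    {ρ σ : Density} (h : reduced V ρ.op = reduced V σ.op) :
    reduced V (E ρ).op = reduced V (E σ).op := by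
  obtain ⟨F, hF, hE⟩ := hE
  rw [reduced_eq_of_block V ρ hF hE, reduced_eq_of_block V σ hF hE, h]

/-! ### Reduced states on nested sets of qubits -/

theorem restrictIdx_eq_iff {U : Set QVar} {i j : EnvIdx} :
    restrictIdx U i = restrictIdx U j ↔ ∀ x ∈ U, i x = j x := by
  rw [Finsupp.ext_iff]
  exact Subtype.forall

/-- The reduced state on `V` determines the one on a subset of `V`. -/
theorem reduced_eq_of_subset {W V : Set QVar} (hWV : W ⊆ V) {ρ σ : Density}
    (h : reduced V ρ.op = reduced V σ.op) : reduced W ρ.op = reduced W σ.op := by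
  classical
  refine op_ext fun a b => ?_
  obtain ⟨a, rfl⟩ := exists_restrictIdx_eq a
  obtain ⟨b, rfl⟩ := exists_restrictIdx_eq b
  -- `f x` is `x` with its qubits in `W` set as in `a`. Summing first over the qubits outside `V`
  -- turns an entry of the reduction to `W` into a sum of entries `(f x, x)` of the reduction to
  -- `V`.
  let f : SubIdx V → SubIdx V := fun x => restrictIdx V (resetIdx W a (joinIdx V x 0))
  have key : ∀ τ : Density, HasSum (fun x : SubIdx V =>
      if restrictIdx W (joinIdx V x 0) = restrictIdx W b then entry (reduced V τ.op) (f x) x else 0)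
      (entry (reduced W τ.op) (restrictIdx W a) (restrictIdx W b)) := by
    intro τ
    refine ((splitIdx V).hasSum_iff.2 (hasSum_entry_reduced_restrict W τ a b)).prod_fiberwise
      fun x => ?_
    have e₁ : ∀ l, restrictIdx W (joinIdx V x l) = restrictIdx W (joinIdx V x 0) := by
      intro l
      rw [restrictIdx_eq_iff]
      intro w hw
      rw [joinIdx_of_mem x l ⟨w, hWV hw⟩, joinIdx_of_mem x 0 ⟨w, hWV hw⟩]
    have e₂ : ∀ l, resetIdx W a (joinIdx V x l) = joinIdx V (f x) l := by
      intro l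
      ext y
      rw [resetIdx_apply, joinIdx_apply, joinIdx_apply]
      by_cases hy : y ∈ V
      · simp [hy, f, restrictIdx_apply, resetIdx_apply, joinIdx_apply]
      · have : y ∉ W := fun h => hy (hWV h)
        simp [hy, this]
    simp only [Function.comp_def, splitIdx, Equiv.coe_fn_mk, e₁, e₂]
    by_cases hx : restrictIdx W (joinIdx V x 0) = restrictIdx W b
    · simpa only [hx, if_true] using hasSum_entry_reduced V τ (f x) x
    · simpa only [hx, if_false] using hasSum_zero
  exact (h ▸ key ρ).unique (key σ)

/-- The reduced state on `V` is determined by those on the finite subsets of `V`. -/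
theorem reduced_eq_of_finite {V : Set QVar} {ρ σ : Density}
    (h : ∀ s : Finset V, reduced (Subtype.val '' (s : Set V)) ρ.op =
      reduced (Subtype.val '' (s : Set V)) σ.op) :
    reduced V ρ.op = reduced V σ.op := by
  classical
  refine op_ext fun a b => ?_
  let U : Finset V → Set QVar := fun s => Subtype.val '' (s : Set V)
  let ia : EnvIdx := joinIdx V a 0
  let ib : EnvIdx := joinIdx V b 0
  have hU : ∀ {s x}, x ∈ U s ↔ ∃ h : x ∈ V, (⟨x, h⟩ : V) ∈ s := by
    intro s x
    simp [U]
  have key : ∀ τ : Density, Filter.Tendsto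
      (fun s : Finset V => entry (reduced (U s) τ.op) (restrictIdx (U s) ia) (restrictIdx (U s) ib))
      Filter.atTop (nhds (entry (reduced V τ.op) a b)) := by
    intro τ
    have hV := hasSum_entry_reduced_restrict V τ ia ib
    have hb : restrictIdx V ib = b := restrictIdx_join V b 0
    rw [restrictIdx_join V a 0, hb] at hV
    rw [← hV.tsum_eq]
    simp only [← (hasSum_entry_reduced_restrict _ τ ia ib).tsum_eq]
    -- Beyond `T` both indices vanish. So once `s` contains `T`, the reset index no longer depends
    -- on `s`, and only the condition that `i` agrees with `b` on `s` still varies.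
    let T : Finset V := a.support ∪ b.support
    have hT : ∀ x (hx : x ∈ V), (⟨x, hx⟩ : V) ∉ T → ia x = 0 ∧ ib x = 0 := by
      intro x hx hxT
      simp only [T, Finset.mem_union, Finsupp.mem_support_iff, not_or, not_not] at hxT
      exact ⟨(joinIdx_of_mem a 0 ⟨x, hx⟩).trans hxT.1, (joinIdx_of_mem b 0 ⟨x, hx⟩).trans hxT.2⟩
    have hreset : ∀ s ⊇ T, ∀ i, restrictIdx (U s) i = restrictIdx (U s) ib →
        resetIdx (U s) ia i = resetIdx (U T) ia i := by
      intro s hs i hi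
      rw [restrictIdx_eq_iff] at hi
      ext x
      rw [resetIdx_apply, resetIdx_apply]
      by_cases hxT : x ∈ U T
      · obtain ⟨h₁, h₂⟩ := hU.1 hxT
        rw [if_pos hxT, if_pos (hU.2 ⟨h₁, hs h₂⟩)]
      · by_cases hxs : x ∈ U s
        · obtain ⟨h₁, -⟩ := hU.1 hxs
          have h₃ := hT x h₁ fun h => hxT (hU.2 ⟨h₁, h⟩)
          rw [if_pos hxs, if_neg hxT, hi x hxs, h₃.1, h₃.2]
        · rw [if_neg hxs, if_neg hxT]
    have hd : Summable fun i => ‖entry τ.op i i‖ := τ.trace_one.summable.norm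
    -- This bound is independent of `s`: agreement on `s` implies agreement on `T`. It is summable
    -- because with the qubits of `T` fixed, both `i` and its reset are injective in the remaining
    -- qubits, so each part is a subsum of the trace.
    let g : EnvIdx → ℝ := fun i => if restrictIdx (U T) i = restrictIdx (U T) ib then
      ‖entry τ.op (resetIdx (U T) ia i) (resetIdx (U T) ia i)‖ + ‖entry τ.op i i‖ else 0
    have hg : Summable g := by
      have hinj := joinIdx_right_injective (U T) (restrictIdx (U T) ib)
      rw [← hinj.summable_iff]
      · have h₁ := hd.comp_injective (joinIdx_right_injective (U T) (restrictIdx (U T) ia))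
        have h₂ := hd.comp_injective hinj
        refine (h₁.add h₂).congr fun k => ?_
        simp [g, restrictIdx_join, resetIdx, restrictIdx_compl_join]
      · intro i hi
        refine if_neg fun h => hi ⟨restrictIdx (U T)ᶜ i, ?_⟩
        exact (congrArg (fun c => joinIdx (U T) c _) h.symm).trans (join_restrictIdx _ i)
    refine tendsto_tsum_of_dominated_convergence (bound := g) hg (fun i => ?_) ?_
    · by_cases hi : restrictIdx V i = restrictIdx V ib
      · have hi' := restrictIdx_eq_iff.1 hi
        refine tendsto_const_nhds.congr' ?_
        filter_upwards [Filter.eventually_ge_atTop T] with s hs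
        have hs' : restrictIdx (U s) i = restrictIdx (U s) ib := by
          rw [restrictIdx_eq_iff]
          exact fun x hx => hi' x (hU.1 hx).1
        rw [if_pos (hi.trans hb), if_pos hs', hreset s hs i hs']
        congr 1
        ext x
        rw [resetIdx_apply, resetIdx_apply]
        by_cases hxT : x ∈ U T
        · rw [if_pos hxT, if_pos (hU.1 hxT).1]
        · by_cases hx : x ∈ V
          · have h₃ := hT x hx fun h => hxT (hU.2 ⟨hx, h⟩)
            rw [if_pos hx, if_neg hxT, hi' x hx, h₃.1, h₃.2]
          · rw [if_neg hx, if_neg hxT]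
      · rw [if_neg fun h => hi (h.trans hb.symm)]
        rw [restrictIdx_eq_iff] at hi
        push Not at hi
        obtain ⟨x, hx, hne⟩ := hi
        refine tendsto_const_nhds.congr' ?_
        filter_upwards [Filter.eventually_ge_atTop {(⟨x, hx⟩ : V)}] with s hs
        rw [if_neg]
        rw [restrictIdx_eq_iff]
        exact fun h => hne (h x (hU.2 ⟨hx, hs (Finset.mem_singleton_self _)⟩))
    · filter_upwards [Filter.eventually_ge_atTop T] with s hs i
      by_cases hi : restrictIdx (U s) i = restrictIdx (U s) ib
      · have hiT : restrictIdx (U T) i = restrictIdx (U T) ib := by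
          rw [restrictIdx_eq_iff] at hi ⊢
          intro x hx
          obtain ⟨h₁, h₂⟩ := hU.1 hx
          exact hi x (hU.2 ⟨h₁, hs h₂⟩)
        rw [if_pos hi, hreset s hs i hi]
        simp only [g, if_pos hiT]
        exact norm_entry_le τ.positive _ _
      · rw [if_neg hi, norm_zero]
        simp only [g]
        split_ifs <;> positivity
  refine tendsto_nhds_unique (key ρ) ?_
  simp only [U, h]
  exact key σ

/-! ### Local expectation values -/

section Local

variable {n : ℕ} (q : Fin n ↪ QVar) (ρ : Density)

theorem entry_unitAt_comp (a b : Bits n) (T : Op EnvIdx) (i j : EnvIdx) :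
    entry (unitAt q a b ∘L T) i j =
      ⟪(ketAt q a).adjoint (ket i), (ketAt q b).adjoint (T (ket j))⟫_ℂ := by
  rw [ContinuousLinearMap.adjoint_inner_left]
  rfl

theorem entry_unitAt_comp_join (a b : Bits n) (T : Op EnvIdx) (k : SubIdx (Set.range q)ᶜ)
    (j : EnvIdx) :
    entry (unitAt q a b ∘L T) (joinIdx (Set.range q) (bitsIdx q a) k) j =
      entry T (joinIdx (Set.range q) (bitsIdx q b) k) j := by
  have h : (ketAt q a).adjoint (ket (joinIdx (Set.range q) (bitsIdx q a) k)) = ket k :=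
    adjoint_basisIsometry_ket _ (joinIdx_right_injective _ _) k
  have h' : ketAt q b (ket k) = ket (joinIdx (Set.range q) (bitsIdx q b) k) :=
    basisIsometry_ket _ (joinIdx_right_injective _ _) k
  rw [entry_unitAt_comp, h, ContinuousLinearMap.adjoint_inner_right, h', entry]

/-- Only basis states equal to `a` on the qubits `q` contribute, and replacing `a` by `b` on the
left index leaves the sum that defines an entry of the reduced state. -/
theorem hasSum_diagEntry_unitAt (a b : Bits n) :
    HasSum (fun i => entry (unitAt q a b ∘L ρ.op) i i)
      (entry (reduced (Set.range q) ρ.op) (bitsIdx q b) (bitsIdx q a)) := by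
  have hinj := joinIdx_right_injective (Set.range q) (bitsIdx q a)
  refine (hinj.hasSum_iff fun i hi => ?_).1 ?_
  · rw [entry_unitAt_comp, ketAt, adjoint_basisIsometry_ket_of_notMem _ hinj i hi, inner_zero_left]
  · have h := hasSum_entry_reduced (Set.range q) ρ (bitsIdx q b) (bitsIdx q a)
    simpa only [Function.comp_def, entry_unitAt_comp_join] using h

/-- The density matrix of the qubits `q`. -/
noncomputable def localState : Matrix (Bits n) (Bits n) ℂ :=
  Matrix.of fun b a => entry (reduced (Set.range q) ρ.op) (bitsIdx q b) (bitsIdx q a)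

theorem localState_isHermitian : (localState q ρ).IsHermitian := by
  ext a b
  exact entry_conj (reduced_isPositive _ ρ) _ _

theorem tr_opAt (A : Matrix (Bits n) (Bits n) ℂ) :
    tr (opAt q A ∘L ρ.op) = (A * localState q ρ).trace := by
  have h : HasSum (fun i => ∑ a, ∑ b, A a b * entry (unitAt q a b ∘L ρ.op) i i)
      (∑ a, ∑ b, A a b * entry (reduced (Set.range q) ρ.op) (bitsIdx q b) (bitsIdx q a)) :=
    hasSum_sum fun a _ => hasSum_sum fun b _ => (hasSum_diagEntry_unitAt q ρ a b).mul_left _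
  have e : diagEntry (opAt q A ∘L ρ.op) =
      fun i => ∑ a, ∑ b, A a b * entry (unitAt q a b ∘L ρ.op) i i := by
    funext i
    simp [diagEntry, entry, opAt]
  rw [tr, e, h.tsum_eq]
  rfl

theorem bitsIdx_surjective : Function.Surjective (bitsIdx q) := by
  intro c
  refine ⟨fun j => c ⟨q j, j, rfl⟩, ?_⟩
  ext ⟨_, j, rfl⟩
  have : (Equiv.ofInjective q q.injective).symm ⟨q j, j, rfl⟩ = j :=
    Equiv.ofInjective_symm_apply q.injective j
  simp [bitsIdx, this]

variable {ρ} {σ : Density}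

theorem reduced_eq_of_localState (h : localState q ρ = localState q σ) :
    reduced (Set.range q) ρ.op = reduced (Set.range q) σ.op := by
  refine op_ext fun a b => ?_
  obtain ⟨a, rfl⟩ := bitsIdx_surjective q a
  obtain ⟨b, rfl⟩ := bitsIdx_surjective q b
  exact congrFun (congrFun h a) b

theorem localState_eq_of_reduced (h : reduced (Set.range q) ρ.op = reduced (Set.range q) σ.op) :
    localState q ρ = localState q σ := by
  unfold localState
  rw [h]

end Local

/-! ### Hermitian matrices and projectors -/

section Matrices

variable {ι : Type} [Fintype ι]

theorem isStarProjection_vecMulVec (x : ι → ℂ) (hx : star x ⬝ᵥ x ≠ 0) :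
    IsStarProjection ((star x ⬝ᵥ x)⁻¹ • Matrix.vecMulVec x (star x)) where
  isIdempotentElem := by
    rw [IsIdempotentElem, Matrix.smul_mul, Matrix.mul_smul, Matrix.vecMulVec_mul_vecMulVec,
      Matrix.vecMulVec_smul, smul_smul, smul_smul, inv_mul_cancel_right₀ hx]
  isSelfAdjoint := by
    have h : star (star x ⬝ᵥ x) = star x ⬝ᵥ x := (Matrix.star_dotProduct x x).symm
    rw [IsSelfAdjoint, star_smul, star_inv₀, h, Matrix.star_eq_conjTranspose,
      Matrix.conjTranspose_vecMulVec, star_star]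

/-- A Hermitian matrix is determined by the real parts of its traces against projectors. -/
theorem eq_of_re_trace_mul_eq {G H : Matrix ι ι ℂ} (hG : G.IsHermitian) (hH : H.IsHermitian)
    (h : ∀ E : Matrix ι ι ℂ, IsStarProjection E → (E * G).trace.re = (E * H).trace.re) :
    G = H := by
  classical
  -- Testing against the rank-one projector onto `x` gives the real part of the quadratic form, up
  -- to the nonzero real factor `1/‖x‖²`; the imaginary part vanishes for Hermitian matrices.
  have key : ∀ x : ι → ℂ, star x ⬝ᵥ (G - H) *ᵥ x = 0 := by
    intro x
    by_cases hx : star x ⬝ᵥ x = 0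
    · rw [dotProduct_star_self_eq_zero.1 hx]
      simp
    · have hE := h _ (isStarProjection_vecMulVec x hx)
      have e : ∀ K : Matrix ι ι ℂ, (((star x ⬝ᵥ x)⁻¹ • Matrix.vecMulVec x (star x)) * K).trace =
          (star x ⬝ᵥ x)⁻¹ * (star x ⬝ᵥ K *ᵥ x) := by
        intro K
        rw [Matrix.smul_mul, Matrix.trace_smul, Matrix.vecMulVec_mul, Matrix.trace_vecMulVec,
          dotProduct_comm x, Matrix.dotProduct_mulVec, smul_eq_mul]
      rw [e, e, ← sub_eq_zero, ← Complex.sub_re, ← mul_sub, ← dotProduct_sub,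
        ← Matrix.sub_mulVec] at hE
      have him : (star x ⬝ᵥ (G - H) *ᵥ x).im = 0 := (hG.sub hH).im_star_dotProduct_mulVec_self x
      have hxim : (star x ⬝ᵥ x).im = 0 := by
        have := (Matrix.isHermitian_one (n := ι) (α := ℂ)).im_star_dotProduct_mulVec_self x
        simpa using this
      have hxre : (star x ⬝ᵥ x).re ≠ 0 := fun h0 => hx (Complex.ext h0 hxim)
      obtain ⟨s, hs⟩ : ∃ s : ℝ, star x ⬝ᵥ x = s := ⟨_, Complex.ext rfl (by simpa using hxim)⟩
      rw [hs, ← Complex.ofReal_inv, Complex.re_ofReal_mul, mul_eq_zero, inv_eq_zero] at hE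
      rw [hs] at hxre
      exact Complex.ext (hE.resolve_left (by simpa using hxre)) him
  -- A vanishing quadratic form is in particular nonnegative, and a positive semidefinite matrix
  -- kills every vector at which its form vanishes.
  have hpos : (G - H).PosSemidef :=
    Matrix.PosSemidef.of_dotProduct_mulVec_nonneg (hG.sub hH) fun x => (key x).ge
  rw [← sub_eq_zero]
  refine Matrix.ext_of_mulVec_single fun i => ?_
  rw [(hpos.dotProduct_mulVec_zero_iff _).1 (key _), Matrix.zero_mulVec]

end Matrices

/-- Expectation values of projectors on finitely many qubits of `V` determine the reduced state. -/
theorem reduced_eq_of_tr_opAt {V : Set QVar} {ρ σ : Density}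
    (h : ∀ (n : ℕ) (q : Fin n ↪ QVar), Set.range q ⊆ V → ∀ E : Projector n,
      (tr (opAt q E.1 ∘L ρ.op)).re = (tr (opAt q E.1 ∘L σ.op)).re) :
    reduced V ρ.op = reduced V σ.op := by
  refine reduced_eq_of_finite fun s => ?_
  let q : Fin s.card ↪ QVar :=
    (s.equivFin.symm.toEmbedding.trans (Function.Embedding.subtype _)).trans
      (Function.Embedding.subtype _)
  have hq : Set.range q = Subtype.val '' (s : Set V) := by
    ext x
    constructor
    · rintro ⟨j, rfl⟩
      exact ⟨_, (s.equivFin.symm j).2, rfl⟩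
    · rintro ⟨y, hy, rfl⟩
      exact ⟨s.equivFin ⟨y, hy⟩, by simp [q]⟩
  have hqV : Set.range q ⊆ V := by
    rw [hq]
    rintro _ ⟨y, -, rfl⟩
    exact y.2
  rw [← hq]
  refine reduced_eq_of_localState q ?_
  refine eq_of_re_trace_mul_eq (localState_isHermitian q ρ) (localState_isHermitian q σ) ?_
  intro E hE
  rw [← tr_opAt, ← tr_opAt]
  exact h _ q hqV ⟨E, hE⟩

theorem tr_opAt_eq_of_reduced {V : Set QVar} {ρ σ : Density} (h : reduced V ρ.op = reduced V σ.op)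
    {n : ℕ} (q : Fin n ↪ QVar) (hq : Set.range q ⊆ V) (A : Matrix (Bits n) (Bits n) ℂ) :
    tr (opAt q A ∘L ρ.op) = tr (opAt q A ∘L σ.op) := by
  rw [tr_opAt, tr_opAt, localState_eq_of_reduced q (reduced_eq_of_subset hq h)]

/-! ### Open bisimilarity -/

variable {L : Signature} {D : Definitions L}

theorem OpenBisimilar.symm {C C' : Con L} (h : OpenBisimilar D C C') : OpenBisimilar D C' C := by
  obtain ⟨R, ⟨h₁, h₂⟩, hR⟩ := h
  exact ⟨fun C C' => R C' C, ⟨h₂, h₁⟩, hR⟩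

theorem isOpenSimulation_openBisimilar : IsOpenSimulation D (OpenBisimilar D) := by
  rintro C C' ⟨R, hR, h⟩
  obtain ⟨h₁, h₂, h₃⟩ := hR.1 C C' h
  refine ⟨h₁, h₂, fun E hE α Δ hs => ?_⟩
  obtain ⟨Θ, hw, hl⟩ := h₃ E hE α Δ hs
  exact ⟨Θ, hw, hl.mono fun s t hst => ⟨R, hR, hst⟩⟩

/-- Open bisimilarity is preserved by super-operators on the other qubits. -/
theorem OpenBisimilar.apply {C C' : Con L} (h : OpenBisimilar D C C') {E : Density → Density}
    (hE : IsSuperOpOn C.qvᶜ E) : OpenBisimilar D (C.apply E) (C'.apply E) := by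
  -- In the simulation clause for this closure, a further `E'` is absorbed as `E' ∘ E`, to which the
  -- clause for the original pair applies.
  let R : Con L → Con L → Prop := fun A A' => ∃ C C' E, OpenBisimilar D C C' ∧
    IsSuperOpOn C.qvᶜ E ∧ A = C.apply E ∧ A' = C'.apply E
  have hR : IsOpenSimulation D R := by
    rintro _ _ ⟨C, C', E, h, hE, rfl, rfl⟩
    obtain ⟨h₁, h₂, h₃⟩ := isOpenSimulation_openBisimilar C C' h
    refine ⟨h₁, hE.reduced_congr h₂, fun E' hE' α Δ hs => ?_⟩
    obtain ⟨Θ, hw, hl⟩ := h₃ (E' ∘ E) (hE'.comp hE) α Δ hs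
    exact ⟨Θ, hw, hl.mono fun s t hst => ⟨s, t, id, hst, isSuperOpOn_id _, rfl, rfl⟩⟩
  have hsymm : (fun A A' => R A' A) = R := by
    have key : ∀ A A', R A A' → R A' A := by
      rintro _ _ ⟨C, C', E, h, hE, rfl, rfl⟩
      exact ⟨C', C, E, h.symm, (isOpenSimulation_openBisimilar C C' h).1 ▸ hE, rfl, rfl⟩
    funext A A'
    exact propext ⟨key A' A, key A A'⟩
  exact ⟨R, ⟨hR, by rwa [hsymm]⟩, C, C', E, h, hE, rfl, rfl⟩

theorem OpenBisimilar.sat {φ : Formula L} : ∀ {C C' : Con L}, OpenBisimilar D C C' →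
    Sat D φ C → Sat D φ C' := by
  classical
  induction φ with
  | atom E q p =>
    rintro C C' h ⟨h₁, h₂⟩
    obtain ⟨hqv, hred, -⟩ := isOpenSimulation_openBisimilar C C' h
    refine ⟨hqv ▸ h₁, ?_⟩
    rwa [← tr_opAt_eq_of_reduced hred q h₁.subset_compl_left]
  | conj I φ ih => exact fun h hs i => ih i h (hs i)
  | neg φ ih => exact fun h hs hs' => hs (ih h.symm hs')
  | sop E φ ih =>
    rintro C C' h ⟨hE, hs⟩
    exact ⟨(isOpenSimulation_openBisimilar C C' h).1 ▸ hE, ih (h.apply hE) hs⟩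
  | diam α p φ ih =>
    rintro C C' h ⟨_, hw, Δs, rfl, hΔ⟩
    obtain ⟨Θ, hw', hl⟩ := isOpenSimulation_openBisimilar.weak (LiftRel.point h) hw
    obtain ⟨Θs, rfl, hΘ⟩ := Lift.split hl
    -- Satisfaction constrains components of weight zero too. The splitting says nothing about them,
    -- so the original ones are kept.
    refine ⟨_, hw', fun i => if p i = 0 then Δs i else Θs i,
      pmf_bind_congr fun i hi => by rw [if_neg hi], fun i A hA => ?_⟩
    by_cases hi : p i = 0
    · simp only [if_pos hi] at hA
      exact hΔ i A hA
    · simp only [if_neg hi] at hA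
      obtain ⟨B, hB, hBA⟩ := LiftRel.exists_of_mem_support (hΘ i hi) A hA
      exact ih i hBA (hΔ i B hB)

/-! ### Logical equivalence -/

theorem LogicallyEquivalent.symm {C C' : Con L} (h : LogicallyEquivalent D C C') :
    LogicallyEquivalent D C' C := fun φ => (h φ).symm

theorem LogicallyEquivalent.qv_subset {C C' : Con L} (h : LogicallyEquivalent D C C') :
    C'.qv ⊆ C.qv := by
  intro x hx
  by_contra hC
  let q : Fin 1 ↪ QVar := ⟨fun _ => x, fun _ _ _ => Subsingleton.elim _ _⟩
  -- With the zero projector and threshold zero, the trace condition is void and the atom says only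
  -- that `x` is not free.
  have h0 := (h (.atom ⟨0, .zero _⟩ q 0)).1 ⟨?_, ?_⟩
  · exact Set.disjoint_left.1 h0.1 hx ⟨0, rfl⟩
  · rw [Set.disjoint_right]
    rintro _ ⟨_, rfl⟩
    exact hC
  · rw [tr_opAt, zero_mul, Matrix.trace_zero, Complex.zero_re]

theorem LogicallyEquivalent.qv_eq {C C' : Con L} (h : LogicallyEquivalent D C C') :
    C.qv = C'.qv :=
  h.symm.qv_subset.antisymm h.qv_subset

theorem LogicallyEquivalent.reduced_eq {C C' : Con L} (h : LogicallyEquivalent D C C') :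
    reduced C.qvᶜ C.state.op = reduced C.qvᶜ C'.state.op := by
  refine reduced_eq_of_tr_opAt fun n q hq E => ?_
  have hd : Disjoint C.qv (Set.range q) := Set.disjoint_right.2 hq
  -- Each threshold is the expectation value in one of the two states, so the atom holds there with
  -- equality.
  exact le_antisymm ((h (.atom E q _)).1 ⟨hd, le_rfl⟩).2
    ((h (.atom E q _)).2 ⟨h.qv_eq ▸ hd, le_rfl⟩).2

theorem LogicallyEquivalent.apply {C C' : Con L} (h : LogicallyEquivalent D C C')
    {E : Density → Density} (hE : IsSuperOpOn C.qvᶜ E) :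
    LogicallyEquivalent D (C.apply E) (C'.apply E) := fun φ =>
  ⟨fun hs => ((h (.sop ⟨E, _, hE⟩ φ)).1 ⟨hE, hs⟩).2,
    fun hs => ((h (.sop ⟨E, _, hE⟩ φ)).2 ⟨h.qv_eq ▸ hE, hs⟩).2⟩

theorem exists_distinguishing {C C' : Con L} (h : ¬ LogicallyEquivalent D C C') :
    ∃ φ : Formula L, Sat D φ C ∧ ¬ Sat D φ C' := by
  unfold LogicallyEquivalent at h
  push Not at h
  obtain ⟨φ, ⟨h₁, h₂⟩ | ⟨h₁, h₂⟩⟩ := h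
  · exact ⟨φ, h₁, h₂⟩
  · exact ⟨.neg φ, h₁, fun hn => hn h₂⟩

/-- Every configuration has a formula that characterizes it up to logical equivalence. -/
theorem exists_characteristic (D : Definitions L) (C : Con L) :
    ∃ φ : Formula L, Sat D φ C ∧ ∀ C', Sat D φ C' → LogicallyEquivalent D C C' := by
  have h : ∀ C', ∃ φ : Formula L, Sat D φ C ∧ (Sat D φ C' → LogicallyEquivalent D C C') := by
    intro C'
    by_cases hC : LogicallyEquivalent D C C'
    -- The empty conjunction is truth, used when there is nothing to distinguish.
    · exact ⟨.conj Empty Empty.elim, fun i => i.elim, fun _ => hC⟩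
    · obtain ⟨φ, h₁, h₂⟩ := exists_distinguishing hC
      exact ⟨φ, h₁, fun h => absurd h h₂⟩
  choose φ h₁ h₂ using h
  exact ⟨.conj (Con L) φ, h₁, fun C' hC' => h₂ C' (hC' C')⟩

theorem isOpenSimulation_logicallyEquivalent : IsOpenSimulation D (LogicallyEquivalent D) := by
  intro C C' h
  refine ⟨h.qv_eq, h.reduced_eq, fun E hE α Δ hs => ?_⟩
  choose χ hχ hχ' using exists_characteristic D
  -- The target becomes a finite mixture of points `e j`, and the diamond asks for a mixture with
  -- the same weights whose `j`-th part satisfies the characteristic formula of `e j`.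
  obtain ⟨n, p, e, -, hb⟩ := pmf_exists_fin Δ hs.finite
  have hΔ : Δ = p.bind fun j => PMF.pure (e j) := by
    rw [← hb PMF.pure, PMF.bind_pure]
  have hsat : Sat D (.diam α p fun j => χ (e j)) (C.apply E) := by
    refine ⟨Δ, hs.weak, fun j => PMF.pure (e j), hΔ, fun j A hA => ?_⟩
    rw [PMF.support_pure, Set.mem_singleton_iff] at hA
    exact hA ▸ hχ _
  obtain ⟨_, hw, Θs, rfl, hΘ⟩ := ((h.apply hE) _).1 hsat
  refine ⟨_, hw, ?_⟩
  rw [hΔ]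
  refine Lift.linear_of_ne_zero p _ _ fun j hj => ?_
  have hfin : (Θs j).support.Finite := by
    refine (hw.finite (by simp)).subset fun A hA => ?_
    exact (PMF.mem_support_bind_iff _ _ _).2 ⟨j, hj, hA⟩
  -- Every state in the support of `Θs j` is equivalent to `e j`. Writing the point at `e j` as a
  -- constant mixture with weights `Θs j` lifts this to distributions.
  have hl := Lift.bind (R := fun s Θ => ∃ t, LogicallyEquivalent D s t ∧ Θ = PMF.pure t) (Θs j) hfin
    (fun _ => PMF.pure (e j)) PMF.pure
    fun A hA => .point ⟨A, hχ' _ _ (hΘ j A ((PMF.mem_support_iff _ _).2 hA)), rfl⟩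
  rwa [PMF.bind_const, PMF.bind_pure] at hl

end QCCS

theorem theoremp (L : QCCS.Signature) (D : QCCS.Definitions L) (C C' : QCCS.Con L) :
    QCCS.OpenBisimilar D C C' ↔ QCCS.LogicallyEquivalent D C C' := by
  refine ⟨fun h φ => ⟨h.sat, h.symm.sat⟩, fun h => ⟨QCCS.LogicallyEquivalent D, ⟨?_, ?_⟩, h⟩⟩
  · exact QCCS.isOpenSimulation_logicallyEquivalent
  · have e : (fun A A' => QCCS.LogicallyEquivalent D A' A) = QCCS.LogicallyEquivalent D := by
      funext A A'
      exact propext ⟨fun h => h.symm, fun h => h.symm⟩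
    rw [e]
    exact QCCS.isOpenSimulation_logicallyEquivalent
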